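/- For a real number $x$ let $\|x\|$ denote the distance from $x$ to the nearest integer. Call a real number $\alpha$ a Liouville number if it is irrational and, for every $w>0$, the inequality $\|n\alpha\|<n^{-w}$ holds for infinitely many positive integers $n$. Let $\alpha_1$ be a Liouville number, and let $\gamma_1,\gamma_2\in\mathbb R$. Then, for almost all $\alpha_2\in\mathbb R$ with respect to Lebesgue measure, $$\liminf_{n\to\infty} n(\log n)^2\,\|n\alpha_1-\gamma_1\|\cdot\|n\alpha_2-\gamma_2\| = 0.$$ -/

import Mathlib

/-- The distance `‖x‖` from a real number `x` to the nearest integer. -/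
noncomputable def distNearestInt (x : ℝ) : ℝ := |x - (round x : ℝ)|

open MeasureTheory Filter Metric
open scoped Topology

/-! Write α, γ for α₁, γ₁, take a reduced fraction a/q extremely close to α, and let P be about
q^(1/10). For t in (P², P³] and j ≤ P choose n = qt + r_j with an ≡ ⌈γq⌉ + j mod q. Then ‖nα - γ‖ is
at most 3j/q and log n is O(log P), so n (log n)² ‖nα - γ‖ is O(tj (log P)²)
(`IsResidueBlock.liouvilleFactor_le`). It suffices that ‖ny - γ₂‖ ≤ b/(tj) for some such n, where b
is of order L/(log P)². The sum of 1/(tj) over the block has order (log P)², so the expected number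
of hits has order L.

The second moment is controlled by a correlation bound whose error involves gcd(n, n')/n', with n'
the larger number (`measureReal_nearMultiples_inter_le`). Pairs with large gcd are rare because of
their congruences, so the weighted gcd sum is again O((log P)²) (`sum_resonances_le`,
`sum_gcdWeight_le`). Chebyshev then bounds the probability of no hit by O(1/L), along arbitrarily
large q.

Finally, scaling the approximation rate by a positive constant changes the limsup set only by a null
set (`limsupNearMultiples_ae_eq`). The bound O(1/L) for every L thus gives full measure for every L,
and L → 0 gives the theorem. -/

/-! ### Multiples of a point on the circle: measure and correlation. -/

theorem UnitAddCircle.norm_coe_le_iff {x a : ℝ} :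
    ‖(x : UnitAddCircle)‖ ≤ a ↔ ∃ z : ℤ, |x - z| ≤ a := by
  rw [UnitAddCircle.norm_eq]
  exact ⟨fun h => ⟨_, h⟩, fun ⟨z, hz⟩ => (round_le x z).trans hz⟩

/-- Points of the circle whose `n`-th multiple lies within `a` of `γ`. -/
def nearMultiples (γ : UnitAddCircle) (n : ℕ) (a : ℝ) : Set UnitAddCircle :=
  {y | ‖n • y - γ‖ ≤ a}

theorem measurableSet_nearMultiples (γ : UnitAddCircle) (n : ℕ) (a : ℝ) :
    MeasurableSet (nearMultiples γ n a) := by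
  apply IsClosed.measurableSet
  exact isClosed_le (by fun_prop) continuous_const

theorem measurePreserving_nsmul_unitAddCircle {n : ℕ} (hn : 0 < n) :
    MeasurePreserving (fun y : UnitAddCircle => n • y) volume volume := by
  rcases Nat.lt_or_ge 1 n with h | h
  · exact (AddCircle.ergodic_nsmul h).toMeasurePreserving
  · obtain rfl : n = 1 := by omega
    simp only [one_smul]
    exact MeasurePreserving.id (volume : Measure UnitAddCircle)

theorem measure_nearMultiples (γ : UnitAddCircle) {n : ℕ} (hn : 0 < n) (a : ℝ) :
    volume (nearMultiples γ n a) = ENNReal.ofReal (min 1 (2 * a)) := by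
  have h : nearMultiples γ n a = (fun y : UnitAddCircle => n • y) ⁻¹' closedBall γ a := by
    ext y
    simp [nearMultiples, dist_eq_norm]
  rw [h, (measurePreserving_nsmul_unitAddCircle hn).measure_preimage
    isClosed_closedBall.measurableSet.nullMeasurableSet, AddCircle.volume_closedBall]

/-- After clearing the denominator, each counted k gives an integer nk - wm in an interval of length
2am. Coprimality makes these integers distinct modulo m, so distinct. -/
theorem card_shifts_near_zero_le {m n : ℕ} (hm : 0 < m) (hmn : n.Coprime m) (z : ℝ) {a : ℝ}
    (ha : 0 ≤ a) :
    (((Finset.range m).filter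
      (fun k : ℕ => ‖((z + n * k / m : ℝ) : UnitAddCircle)‖ ≤ a)).card : ℝ) ≤ 2 * a * m + 1 := by
  classical
  have hm' : (0 : ℝ) < m := by exact_mod_cast hm
  have hw : ∀ k : ℕ, ∃ w : ℤ, ‖((z + n * k / m : ℝ) : UnitAddCircle)‖ ≤ a →
      |z + n * k / m - w| ≤ a := by
    intro k
    by_cases h : ‖((z + n * k / m : ℝ) : UnitAddCircle)‖ ≤ a
    · obtain ⟨w, hw⟩ := UnitAddCircle.norm_coe_le_iff.1 h
      exact ⟨w, fun _ => hw⟩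
    · exact ⟨0, fun h' => absurd h' h⟩
  choose w hw using hw
  have hcard : ((Finset.range m).filter
      (fun k : ℕ => ‖((z + n * k / m : ℝ) : UnitAddCircle)‖ ≤ a)).card ≤
      (Finset.Icc ⌈-(z * m) - a * m⌉ ⌊-(z * m) + a * m⌋).card := by
    apply Finset.card_le_card_of_injOn (fun k => n * k - w k * m)
    · intro k hk
      simp only [Finset.coe_filter, Finset.mem_range, Set.mem_ofPred_eq] at hk
      have h := abs_le.1 (hw k hk.2)
      have e : z + n * k / m - w k = (z * m + (n * k - w k * m)) / m := by field_simp; ring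
      rw [e, le_div_iff₀ hm', div_le_iff₀ hm'] at h
      simp only [Finset.coe_Icc, Set.mem_Icc, Int.ceil_le, Int.le_floor]
      push_cast
      constructor <;> linarith
    · intro k hk l hl hkl
      simp only [Finset.coe_filter, Finset.mem_range, Set.mem_ofPred_eq] at hk hl
      have h1 : (m : ℤ) ∣ n * ((k : ℤ) - l) := ⟨w k - w l, by linear_combination hkl⟩
      have h2 : (m : ℤ) ∣ (k : ℤ) - l :=
        (Nat.isCoprime_iff_coprime.2 hmn).symm.dvd_of_dvd_mul_left h1
      have h3 := Int.eq_zero_of_abs_lt_dvd h2 (by rw [abs_lt]; omega)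
      omega
  refine (Nat.cast_le.2 hcard).trans ?_
  rw [Int.card_Icc]
  have h1 := Int.floor_le (-(z * m) + a * m)
  have h2 := Int.le_ceil (-(z * m) - a * m)
  have h3 : (0 : ℝ) ≤ 2 * a * m + 1 := by positivity
  rcases le_total (⌊-(z * m) + a * m⌋ + 1 - ⌈-(z * m) - a * m⌉) 0 with h | h
  · rw [Int.toNat_of_nonpos h]; simpa using h3
  · rw [← Int.cast_natCast (R := ℝ), Int.toNat_of_nonneg h]
    push_cast
    linarith

/-- Correlation bound for the events `‖n y - γ‖ ≤ a` and `‖m y - γ‖ ≤ b`. -/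
theorem measureReal_nearMultiples_inter_le (γ : UnitAddCircle) {m n : ℕ} (hm : 0 < m) {a b : ℝ}
    (ha : 0 ≤ a) (hb : 0 ≤ b) :
    volume.real (nearMultiples γ n a ∩ nearMultiples γ m b) ≤
      2 * b * (2 * a + n.gcd m / m) := by
  classical
  set d := n.gcd m with hd
  have hd0 : 0 < d := Nat.gcd_pos_of_pos_right _ hm
  obtain ⟨n', hn'⟩ : d ∣ n := Nat.gcd_dvd_left _ _
  obtain ⟨m', hm'⟩ : d ∣ m := Nat.gcd_dvd_right _ _
  have hm'0 : 0 < m' := Nat.pos_of_ne_zero (by rintro rfl; omega)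
  have hcop : n'.Coprime m' := by
    have := Nat.coprime_div_gcd_div_gcd (m := n) (n := m) hd0
    rw [← hd] at this
    rwa [hn', hm', Nat.mul_div_cancel_left _ hd0, Nat.mul_div_cancel_left _ hd0] at this
  have hmR : (0 : ℝ) < m := by exact_mod_cast hm
  have hm'R : (0 : ℝ) < m' := by exact_mod_cast hm'0
  have hdR : (0 : ℝ) < d := by exact_mod_cast hd0
  have em : (m : ℝ) = d * m' := by exact_mod_cast hm'
  have en : (n : ℝ) = d * n' := by exact_mod_cast hn'
  set A := nearMultiples γ n a
  set B := nearMultiples γ m b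
  have hA : MeasurableSet A := measurableSet_nearMultiples _ _ _
  have hB : MeasurableSet B := measurableSet_nearMultiples _ _ _
  -- Shifts by k/m preserve `B`, so the measure of the intersection is the average over m' = m/d
  -- shifts of `A`. Multiplication by n turns these into steps of n'/m', and each point lies in few
  -- of the shifted sets.
  let τ : ℕ → UnitAddCircle := fun k => ((k / m : ℝ) : UnitAddCircle)
  have hτm : ∀ k, m • τ k = 0 := by
    intro k
    have : m • τ k = (((k : ℤ) : ℝ) : UnitAddCircle) := by
      show m • ((k / m : ℝ) : UnitAddCircle) = _
      rw [← AddCircle.coe_nsmul, nsmul_eq_mul]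
      congr 1
      push_cast
      field_simp
    rw [this]
    exact (AddCircle.coe_eq_zero_iff (1 : ℝ)).2 ⟨k, by simp⟩
  have hshift : ∀ k, volume (A ∩ B) = volume ((fun y => y + τ k) ⁻¹' A ∩ B) := by
    intro k
    have : (fun y => y + τ k) ⁻¹' A ∩ B = (fun y => y + τ k) ⁻¹' (A ∩ B) := by
      ext y
      simp only [Set.mem_inter_iff, Set.mem_preimage]
      refine and_congr_right fun _ => ?_
      simp only [B, nearMultiples, Set.mem_ofPred_eq, smul_add, hτm, add_zero]
    rw [this, measure_preimage_add_right]
  have hcount : ∀ y : UnitAddCircle,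
      ∑ k ∈ Finset.range m', ((fun y => y + τ k) ⁻¹' A).indicator (1 : UnitAddCircle → ENNReal) y ≤
        ENNReal.ofReal (2 * a * m' + 1) := by
    intro y
    obtain ⟨z, hz⟩ : ∃ z : ℝ, (z : UnitAddCircle) = n • y - γ := QuotientAddGroup.mk_surjective _
    have e : ∀ k, y ∈ (fun y => y + τ k) ⁻¹' A ↔
        ‖((z + n' * k / m' : ℝ) : UnitAddCircle)‖ ≤ a := by
      intro k
      have : ((z + n' * k / m' : ℝ) : UnitAddCircle) = n • (y + τ k) - γ := by
        rw [AddCircle.coe_add, hz, smul_add]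
        have : n • τ k = ((n' * k / m' : ℝ) : UnitAddCircle) := by
          show n • ((k / m : ℝ) : UnitAddCircle) = _
          rw [← AddCircle.coe_nsmul, nsmul_eq_mul, em, en]
          congr 1
          field_simp
        rw [this]
        abel
      rw [this]
      rfl
    have : ∑ k ∈ Finset.range m',
        ((fun y => y + τ k) ⁻¹' A).indicator (1 : UnitAddCircle → ENNReal) y =
        (((Finset.range m').filter
          (fun k : ℕ => ‖((z + n' * k / m' : ℝ) : UnitAddCircle)‖ ≤ a)).card : ENNReal) := by
      rw [Finset.card_filter, Nat.cast_sum]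
      refine Finset.sum_congr rfl fun k _ => ?_
      simp only [Set.indicator_apply, e k, Pi.one_apply, Nat.cast_ite, Nat.cast_one, Nat.cast_zero]
    rw [this, ← ENNReal.ofReal_natCast]
    exact ENNReal.ofReal_le_ofReal (card_shifts_near_zero_le hm'0 hcop z ha)
  have hmain : (m' : ENNReal) * volume (A ∩ B) ≤
      ENNReal.ofReal (2 * a * m' + 1) * ENNReal.ofReal (2 * b) := by
    calc (m' : ENNReal) * volume (A ∩ B)
        = ∑ k ∈ Finset.range m', volume ((fun y => y + τ k) ⁻¹' A ∩ B) := by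
          rw [← Finset.sum_congr rfl (fun k _ => hshift k)]
          simp
      _ = ∑ k ∈ Finset.range m',
            ∫⁻ y in B, ((fun y => y + τ k) ⁻¹' A).indicator (1 : UnitAddCircle → ENNReal) y := by
          refine Finset.sum_congr rfl fun k _ => ?_
          have hk : MeasurableSet ((fun y => y + τ k) ⁻¹' A) := (measurable_add_const _) hA
          rw [lintegral_indicator_one hk, Measure.restrict_apply hk]
      _ = ∫⁻ y in B, ∑ k ∈ Finset.range m',
            ((fun y => y + τ k) ⁻¹' A).indicator (1 : UnitAddCircle → ENNReal) y := by
          rw [lintegral_finsetSum]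
          exact fun k _ => measurable_one.indicator ((measurable_add_const _) hA)
      _ ≤ ∫⁻ y in B, ENNReal.ofReal (2 * a * m' + 1) := lintegral_mono fun y => hcount y
      _ = ENNReal.ofReal (2 * a * m' + 1) * volume B := by simp
      _ ≤ _ := by
          gcongr
          rw [measure_nearMultiples γ hm]
          exact ENNReal.ofReal_le_ofReal (min_le_right _ _)
  have h2 : (m' : ℝ) * volume.real (A ∩ B) ≤ (2 * a * m' + 1) * (2 * b) := by
    have := ENNReal.toReal_mono (by finiteness) hmain
    rwa [ENNReal.toReal_mul, ENNReal.toReal_mul, ENNReal.toReal_natCast,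
      ENNReal.toReal_ofReal (by positivity), ENNReal.toReal_ofReal (by positivity)] at this
  have h3 : (d : ℝ) / m = 1 / m' := by rw [em]; field_simp
  rw [h3]
  have : 2 * b * (2 * a + 1 / m') = (2 * a * m' + 1) * (2 * b) / m' := by field_simp
  rw [this, le_div_iff₀ hm'R]
  linarith

/-! ### Second moments and comparison of finite sums. -/

/-- Chebyshev's inequality for the number of events that occur. -/
theorem measureReal_compl_mul_sum_sq_le {Ω ι : Type*} [MeasurableSpace Ω] (μ : Measure Ω)
    [IsProbabilityMeasure μ] (s : Finset ι) (A : ι → Set Ω) (hA : ∀ i, MeasurableSet (A i)) :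
    μ.real (⋂ i ∈ s, (A i)ᶜ) * (∑ i ∈ s, μ.real (A i)) ^ 2 ≤
      ∑ i ∈ s, ∑ j ∈ s, (μ.real (A i ∩ A j) - μ.real (A i) * μ.real (A j)) := by
  classical
  set E := ∑ i ∈ s, μ.real (A i) with hE
  set Z := ⋂ i ∈ s, (A i)ᶜ
  have hZ : MeasurableSet Z := Finset.measurableSet_biInter _ fun i _ => (hA i).compl
  let f : ι → Ω → ℝ := fun i => (A i).indicator 1
  have hprod : ∀ i j, (fun ω => f i ω * f j ω) = (A i ∩ A j).indicator 1 := by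
    intro i j
    rw [Set.inter_indicator_one]
    rfl
  have hfi : ∀ i j, Integrable (fun ω => f i ω * f j ω) μ := by
    intro i j
    rw [hprod]
    exact (integrable_const (1 : ℝ)).indicator ((hA i).inter (hA j))
  have hff : ∀ i j, ∫ ω, f i ω * f j ω ∂μ = μ.real (A i ∩ A j) := by
    intro i j
    rw [hprod, integral_indicator_one ((hA i).inter (hA j))]
  have hf1 : ∀ i, Integrable (f i) μ := fun i => (integrable_const (1 : ℝ)).indicator (hA i)
  have hfe : ∀ i, ∫ ω, f i ω ∂μ = μ.real (A i) := fun i => integral_indicator_one (hA i)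
  -- The right side is the square of (number of events - `E`), which equals `E ^ 2` where no event
  -- occurs.
  have hpt : ∀ ω, Z.indicator (fun _ => E ^ 2) ω ≤
      (∑ i ∈ s, ∑ j ∈ s, f i ω * f j ω) - 2 * E * (∑ i ∈ s, f i ω) + E ^ 2 := by
    intro ω
    have e : (∑ i ∈ s, ∑ j ∈ s, f i ω * f j ω) - 2 * E * (∑ i ∈ s, f i ω) + E ^ 2 =
        (∑ i ∈ s, f i ω - E) ^ 2 := by
      rw [← Finset.sum_mul_sum]; ring
    rw [e]
    by_cases h : ω ∈ Z
    · rw [Set.indicator_of_mem h]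
      have : ∑ i ∈ s, f i ω = 0 := Finset.sum_eq_zero fun i hi =>
        Set.indicator_of_notMem (Set.mem_iInter₂.1 h i hi) _
      rw [this]; simp
    · rw [Set.indicator_of_notMem h]; positivity
  have hi2 : Integrable (fun ω => ∑ i ∈ s, ∑ j ∈ s, f i ω * f j ω) μ :=
    integrable_finsetSum _ fun i _ => integrable_finsetSum _ fun j _ => hfi i j
  have hi1 : Integrable (fun ω => 2 * E * (∑ i ∈ s, f i ω)) μ :=
    (integrable_finsetSum _ fun i _ => hf1 i).const_mul _
  have h := integral_mono ((integrable_const (E ^ 2)).indicator hZ)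
    ((hi2.sub hi1).add (integrable_const (E ^ 2))) hpt
  rw [integral_indicator_const _ hZ] at h
  rw [integral_add' (hi2.sub hi1) (integrable_const _), integral_sub' hi2 hi1, integral_const_mul, integral_finsetSum _ fun i _ => hf1 i,
    integral_finsetSum _ fun i _ => integrable_finsetSum _ fun j _ => hfi i j] at h
  simp only [integral_finsetSum _ fun j _ => hfi _ j, hff, hfe, integral_const, smul_eq_mul,
    probReal_univ, one_mul, ← hE] at h
  simp only [Finset.sum_sub_distrib, ← Finset.sum_mul_sum, ← hE]
  linarith [h]

theorem Finset.sum_le_sum_of_injOn_le {α β : Type*} {U : Finset α} {V : Finset β} (φ : α → β)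
    (hmaps : ∀ p ∈ U, φ p ∈ V) (hinj : Set.InjOn φ U) {w : α → ℝ} {v : β → ℝ}
    (hw : ∀ p ∈ U, w p ≤ v (φ p)) (hv : ∀ b ∈ V, 0 ≤ v b) :
    ∑ p ∈ U, w p ≤ ∑ b ∈ V, v b := by
  classical
  calc ∑ p ∈ U, w p ≤ ∑ p ∈ U, v (φ p) := Finset.sum_le_sum hw
    _ = ∑ b ∈ U.image φ, v b := (Finset.sum_image hinj).symm
    _ ≤ ∑ b ∈ V, v b := by
        refine Finset.sum_le_sum_of_subset_of_nonneg ?_ fun b hb _ => hv b hb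
        intro b hb
        obtain ⟨p, hp, rfl⟩ := Finset.mem_image.1 hb
        exact hmaps p hp

theorem Finset.sum_product_mul_eq {α β : Type*} {s : Finset α} {t : Finset β} (f : α → ℝ)
    (g : β → ℝ) : ∑ x ∈ s ×ˢ t, f x.1 * g x.2 = (∑ x ∈ s, f x) * ∑ y ∈ t, g y := by
  rw [Finset.sum_mul_sum, ← Finset.sum_product' s t fun x y => f x * g y]

/-! ### Rigidity of congruences between small numbers. -/

/-- Multiples `d₁ (m, n)`, `d₂ (m, n)` of one primitive vector, whose images under multiplication
by `a` modulo `q` are both close to `(c, c)`, differ by a multiple of the same vector. -/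
theorem mul_sub_eq_mul_sub_of_dvd {q a c d₁ d₂ m n i₁ i₂ j₁ j₂ B : ℤ}
    (hi₁ : q ∣ a * (d₁ * m) - (c + i₁)) (hi₂ : q ∣ a * (d₂ * m) - (c + i₂))
    (hj₁ : q ∣ a * (d₁ * n) - (c + j₁)) (hj₂ : q ∣ a * (d₂ * n) - (c + j₂))
    (hB : |n * (i₁ - i₂)| ≤ B) (hB' : |m * (j₁ - j₂)| ≤ B) (hBq : 2 * B < q) :
    n * (i₁ - i₂) = m * (j₁ - j₂) := by
  have h : q ∣ n * (i₁ - i₂) - m * (j₁ - j₂) := by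
    obtain ⟨k₁, h₁⟩ := hi₁
    obtain ⟨k₂, h₂⟩ := hi₂
    obtain ⟨k₃, h₃⟩ := hj₁
    obtain ⟨k₄, h₄⟩ := hj₂
    exact ⟨m * (k₃ - k₄) - n * (k₁ - k₂), by linear_combination m * (h₃ - h₄) - n * (h₁ - h₂)⟩
  have h1 := abs_sub (n * (i₁ - i₂)) (m * (j₁ - j₂))
  have := Int.eq_zero_of_abs_lt_dvd h (by linarith)
  linarith

/-- If `m : n` is the ratio of two numbers with prescribed distinct residues modulo `q`, and `m, n`
are small and coprime, then `m` and `n` are determined by the residues. -/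
theorem eq_and_eq_of_dvd_cross {q c i j : ℤ} {m₁ n₁ m₂ n₂ : ℕ} (hij : i ≠ j)
    (h₁ : q ∣ n₁ * (c + i) - m₁ * (c + j)) (h₂ : q ∣ n₂ * (c + i) - m₂ * (c + j))
    (hc₁ : m₁.Coprime n₁) (hc₂ : m₂.Coprime n₂)
    (hlt : |((n₁ : ℤ) * m₂ - n₂ * m₁) * (i - j)| < q) : m₁ = m₂ ∧ n₁ = n₂ := by
  have h : q ∣ ((n₁ : ℤ) * m₂ - n₂ * m₁) * (i - j) := by
    obtain ⟨k₁, h₁⟩ := h₁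
    obtain ⟨k₂, h₂⟩ := h₂
    exact ⟨k₁ * (m₂ - n₂) - k₂ * (m₁ - n₁),
      by linear_combination (m₂ - n₂ : ℤ) * h₁ - (m₁ - n₁ : ℤ) * h₂⟩
  have h0 := Int.eq_zero_of_abs_lt_dvd h hlt
  have h1 : n₁ * m₂ = n₂ * m₁ := by
    rcases mul_eq_zero.1 h0 with h | h
    · zify; linarith
    · exact absurd (by linarith) hij
  have hm : m₁ = m₂ := Nat.dvd_antisymm
    (hc₁.dvd_of_dvd_mul_left (h1 ▸ Dvd.intro_left _ rfl))
    (hc₂.dvd_of_dvd_mul_left (h1 ▸ Dvd.intro_left _ rfl))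
  have hn : n₁ = n₂ := Nat.dvd_antisymm
    (hc₁.symm.dvd_of_dvd_mul_right (h1 ▸ Dvd.intro _ rfl))
    (hc₂.symm.dvd_of_dvd_mul_right (h1 ▸ Dvd.intro _ rfl))
  exact ⟨hm, hn⟩

theorem dvd_sub_of_dvd_mul_sub {q a m n d₁ d₂ : ℤ} (ha : IsCoprime a q) (hmn : IsCoprime m n)
    (hm : q ∣ a * (d₁ * m) - a * (d₂ * m)) (hn : q ∣ a * (d₁ * n) - a * (d₂ * n)) :
    q ∣ d₁ - d₂ := by
  obtain ⟨u, v, huv⟩ := hmn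
  apply ha.symm.dvd_of_dvd_mul_left
  have := dvd_add (dvd_mul_of_dvd_right hm u) (dvd_mul_of_dvd_right hn v)
  convert this using 1
  linear_combination (-(a * (d₁ - d₂))) * huv

/-! ### Harmonic sums. -/

/-- Sum of reciprocals `1 + 1/2 + ⋯ + 1/n`. -/
noncomputable def recipSum (n : ℕ) : ℝ := ∑ k ∈ Finset.Icc 1 n, (k : ℝ)⁻¹

theorem recipSum_nonneg (n : ℕ) : 0 ≤ recipSum n := Finset.sum_nonneg fun _ _ => by positivity

theorem recipSum_eq_harmonic (n : ℕ) : recipSum n = harmonic n := by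
  simp [recipSum, harmonic_eq_sum_Icc]

theorem recipSum_le (n : ℕ) : recipSum n ≤ 1 + Real.log n :=
  recipSum_eq_harmonic n ▸ harmonic_le_one_add_log n

theorem log_le_recipSum {n : ℕ} (hn : 0 < n) : Real.log n ≤ recipSum n := by
  rw [recipSum_eq_harmonic]
  refine le_trans ?_ (log_add_one_le_harmonic n)
  gcongr
  simp

theorem sum_sum_ite_le_le (M : ℕ) (g : ℕ → ℝ) (hg : ∀ m, 0 ≤ g m) :
    ∑ m ∈ Finset.Icc 1 M, ∑ n ∈ Finset.Icc 1 M, (if n ≤ m then g m else 0) ≤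
      ∑ m ∈ Finset.Icc 1 M, m * g m := by
  refine Finset.sum_le_sum fun m _ => ?_
  rw [← Finset.sum_filter, Finset.sum_const, nsmul_eq_mul]
  gcongr
  · exact hg m
  · calc _ ≤ (Finset.Icc 1 m).card := Finset.card_le_card fun n hn => by
          simp only [Finset.mem_filter, Finset.mem_Icc] at hn ⊢; omega
      _ = m := by simp

theorem sum_inv_sq_le_two (M : ℕ) : ∑ m ∈ Finset.Icc 1 M, ((m : ℝ) ^ 2)⁻¹ ≤ 2 := by
  have h := sum_Ioo_inv_sq_le (α := ℝ) 0 (M + 1)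
  have e : Finset.Ioo 0 (M + 1) = Finset.Icc 1 M := by ext; simp; omega
  rw [e] at h
  simpa using h

/-! ### Residue blocks and their resonant pairs. -/

/-- Data for the numbers `n = q t + r j` with `a n ≡ c + j` modulo `q`: the parameters `j ∈ J` are at
most `P`, where `P` is a small power of `q`, and `c + j` is not annihilated modulo `q` by a small
factor. -/
structure IsResidueBlock (q P : ℕ) (a c : ℤ) (r : ℕ → ℕ) (J : Finset ℕ) : Prop where
  coprime : IsCoprime a q
  two_le : 2 ≤ P
  pow_le : P ^ 10 ≤ q
  residue : ∀ j, (q : ℤ) ∣ a * r j - (c + j)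
  subset : J ⊆ Finset.Icc 1 P
  not_dvd : ∀ j ∈ J, ∀ k : ℕ, 0 < k → k < P ^ 4 → ¬ (q : ℤ) ∣ k * (c + j)

/-- The number with quotient `i.1` and residue index `i.2`. -/
def blockValue (q : ℕ) (r : ℕ → ℕ) (i : ℕ × ℕ) : ℕ := q * i.1 + r i.2

/-- The index set of a residue block. -/
def blockIndex (P : ℕ) (J : Finset ℕ) : Finset (ℕ × ℕ) := Finset.Ioc (P ^ 2) (P ^ 3) ×ˢ J

/-- Pairs of a residue block whose greatest common divisor is exceptionally large. -/
def blockResonances (q P : ℕ) (r : ℕ → ℕ) (J : Finset ℕ) : Finset ((ℕ × ℕ) × (ℕ × ℕ)) :=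
  (blockIndex P J ×ˢ blockIndex P J).filter fun p =>
    blockValue q r p.1 < blockValue q r p.2 ∧
      blockValue q r p.2 / (blockValue q r p.1).gcd (blockValue q r p.2) < P ^ 4

/-- The larger element of a pair of numbers of a block, divided by the gcd of the pair. -/
def reducedLarge (q : ℕ) (r : ℕ → ℕ) (p : (ℕ × ℕ) × (ℕ × ℕ)) : ℕ :=
  blockValue q r p.2 / (blockValue q r p.1).gcd (blockValue q r p.2)

/-- The smaller element of a pair of numbers of a block, divided by the gcd of the pair. -/
def reducedSmall (q : ℕ) (r : ℕ → ℕ) (p : (ℕ × ℕ) × (ℕ × ℕ)) : ℕ :=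
  blockValue q r p.1 / (blockValue q r p.1).gcd (blockValue q r p.2)

namespace IsResidueBlock

variable {q P : ℕ} {a c : ℤ} {r : ℕ → ℕ} {J : Finset ℕ}

theorem pos (h : IsResidueBlock q P a c r J) : 0 < q :=
  lt_of_lt_of_le (pow_pos (by linarith [h.two_le]) _) h.pow_le

theorem resonance_spec (h : IsResidueBlock q P a c r J) {p : (ℕ × ℕ) × (ℕ × ℕ)}
    (hp : p ∈ blockResonances q P r J) : ∃ d : ℕ,
      blockValue q r p.2 = d * reducedLarge q r p ∧ blockValue q r p.1 = d * reducedSmall q r p ∧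
      (reducedLarge q r p).Coprime (reducedSmall q r p) ∧ 0 < reducedSmall q r p ∧
      reducedSmall q r p < reducedLarge q r p ∧ reducedLarge q r p < P ^ 4 := by
  simp only [blockResonances, Finset.mem_filter, Finset.mem_product, blockIndex,
    Finset.mem_Ioc] at hp
  obtain ⟨⟨⟨⟨ht, -⟩, -⟩, -⟩, hlt, hM⟩ := hp
  have hx : 0 < blockValue q r p.1 := by
    have := Nat.mul_pos h.pos (lt_of_le_of_lt (Nat.zero_le _) ht)
    unfold blockValue; omega
  set d := (blockValue q r p.1).gcd (blockValue q r p.2) with hd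
  have hd0 : 0 < d := Nat.gcd_pos_of_pos_left _ hx
  have e2 : blockValue q r p.2 = d * reducedLarge q r p :=
    (Nat.mul_div_cancel' (Nat.gcd_dvd_right _ _)).symm
  have e1 : blockValue q r p.1 = d * reducedSmall q r p :=
    (Nat.mul_div_cancel' (Nat.gcd_dvd_left _ _)).symm
  refine ⟨d, e2, e1, (Nat.coprime_div_gcd_div_gcd hd0).symm, ?_, ?_, hM⟩
  · exact Nat.pos_of_ne_zero fun h0 => by rw [h0] at e1; omega
  · rw [e1, e2] at hlt
    exact Nat.lt_of_mul_lt_mul_left hlt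

theorem dvd_blockValue (h : IsResidueBlock q P a c r J) (i : ℕ × ℕ) :
    (q : ℤ) ∣ a * blockValue q r i - (c + i.2) := by
  obtain ⟨k, hk⟩ := h.residue i.2
  refine ⟨k + a * i.1, ?_⟩
  unfold blockValue
  push_cast
  linear_combination hk

theorem snd_mem (h : IsResidueBlock q P a c r J) {p : (ℕ × ℕ) × (ℕ × ℕ)}
    (hp : p ∈ blockResonances q P r J) :
    p.1.2 ∈ J ∧ p.2.2 ∈ J ∧ 1 ≤ p.1.2 ∧ p.1.2 ≤ P ∧ 1 ≤ p.2.2 ∧ p.2.2 ≤ P := by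
  simp only [blockResonances, Finset.mem_filter, Finset.mem_product, blockIndex,
    Finset.mem_Ioc] at hp
  obtain ⟨⟨⟨-, h1⟩, -, h2⟩, -⟩ := hp
  have h1' := Finset.mem_Icc.1 (h.subset h1)
  have h2' := Finset.mem_Icc.1 (h.subset h2)
  exact ⟨h1, h2, h1'.1, h1'.2, h2'.1, h2'.2⟩

theorem fst_mem {p : (ℕ × ℕ) × (ℕ × ℕ)}
    (hp : p ∈ blockResonances q P r J) : P ^ 2 < p.2.1 ∧ p.2.1 ≤ P ^ 3 := by
  simp only [blockResonances, Finset.mem_filter, Finset.mem_product, blockIndex,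
    Finset.mem_Ioc] at hp
  exact hp.1.2.1

/-- Multiplying the two block congruences crosswise by the reduced numbers eliminates the common
gcd. -/
theorem cross_dvd (h : IsResidueBlock q P a c r J) {p : (ℕ × ℕ) × (ℕ × ℕ)}
    (hp : p ∈ blockResonances q P r J) :
    (q : ℤ) ∣ reducedSmall q r p * (c + p.2.2) - reducedLarge q r p * (c + p.1.2) := by
  obtain ⟨d, e2, e1, -⟩ := h.resonance_spec hp
  obtain ⟨k₁, h₁⟩ := h.dvd_blockValue p.1
  obtain ⟨k₂, h₂⟩ := h.dvd_blockValue p.2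
  rw [e1] at h₁
  rw [e2] at h₂
  push_cast at h₁ h₂
  exact ⟨reducedLarge q r p * k₁ - reducedSmall q r p * k₂, by
    linear_combination (reducedLarge q r p : ℤ) * h₁ - (reducedSmall q r p : ℤ) * h₂⟩

/-- For equal residues the cross congruence says that a positive factor below P⁴ kills c + j modulo
q, which `not_dvd` forbids. -/
theorem snd_ne (h : IsResidueBlock q P a c r J) {p : (ℕ × ℕ) × (ℕ × ℕ)}
    (hp : p ∈ blockResonances q P r J) : p.2.2 ≠ p.1.2 := by
  intro he
  obtain ⟨d, -, -, -, h0, hlt, hM⟩ := h.resonance_spec hp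
  refine h.not_dvd _ (h.snd_mem hp).1 (reducedLarge q r p - reducedSmall q r p) (by omega)
    (by omega) ?_
  obtain ⟨k, hk⟩ := h.cross_dvd hp
  rw [he] at hk
  rw [Nat.cast_sub hlt.le]
  exact ⟨-k, by linear_combination -hk⟩

theorem reduced_eq_of_snd_eq (h : IsResidueBlock q P a c r J) {p p' : (ℕ × ℕ) × (ℕ × ℕ)}
    (hp : p ∈ blockResonances q P r J) (hp' : p' ∈ blockResonances q P r J)
    (h1 : p.1.2 = p'.1.2) (h2 : p.2.2 = p'.2.2) :
    reducedLarge q r p = reducedLarge q r p' ∧ reducedSmall q r p = reducedSmall q r p' := by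
  obtain ⟨d, -, -, hc, h0, hlt, hM⟩ := h.resonance_spec hp
  obtain ⟨d', -, -, hc', h0', hlt', hM'⟩ := h.resonance_spec hp'
  have hne := h.snd_ne hp
  have hd := h.cross_dvd hp
  have hd' := h.cross_dvd hp'
  rw [← h1, ← h2] at hd'
  refine eq_and_eq_of_dvd_cross (fun e => hne (by exact_mod_cast e)) hd hd' hc hc' ?_
  obtain ⟨-, -, -, b1, -, b2⟩ := h.snd_mem hp
  have hP := h.two_le
  have k1 : |((reducedSmall q r p : ℤ) * reducedLarge q r p' -
      reducedSmall q r p' * reducedLarge q r p)| ≤ (P : ℤ) ^ 8 := by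
    have u1 : reducedSmall q r p * reducedLarge q r p' ≤ P ^ 4 * P ^ 4 :=
      Nat.mul_le_mul (by omega) (by omega)
    have u2 : reducedSmall q r p' * reducedLarge q r p ≤ P ^ 4 * P ^ 4 :=
      Nat.mul_le_mul (by omega) (by omega)
    zify at u1 u2
    have u3 : (0 : ℤ) ≤ reducedSmall q r p * reducedLarge q r p' := by positivity
    have u4 : (0 : ℤ) ≤ reducedSmall q r p' * reducedLarge q r p := by positivity
    rw [abs_le]
    constructor <;> nlinarith
  have k2 : |((p.2.2 : ℤ) - p.1.2)| ≤ P := by rw [abs_le]; omega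
  have k3 : P ^ 8 * P < q := by
    calc P ^ 8 * P = P ^ 9 := by ring
      _ < P ^ 10 := Nat.pow_lt_pow_right hP (by norm_num)
      _ ≤ q := h.pow_le
  rw [abs_mul]
  calc _ ≤ (P : ℤ) ^ 8 * P := by gcongr
    _ < q := by exact_mod_cast k3

/-- With the reduced pair (m, n) fixed, m divides the difference of the two larger residue indices,
so their equal quotients by m force equality. Then q divides the difference of the gcds, hence m
divides the difference of the t's, and the same argument applies. -/
theorem eq_of_reduced_eq (h : IsResidueBlock q P a c r J) {p p' : (ℕ × ℕ) × (ℕ × ℕ)}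
    (hp : p ∈ blockResonances q P r J) (hp' : p' ∈ blockResonances q P r J)
    (hL : reducedLarge q r p = reducedLarge q r p') (hS : reducedSmall q r p = reducedSmall q r p')
    (hj : p.2.2 / reducedLarge q r p = p'.2.2 / reducedLarge q r p)
    (ht : p.2.1 / reducedLarge q r p = p'.2.1 / reducedLarge q r p) : p = p' := by
  obtain ⟨d, e2, e1, hc, h0, hlt, hM⟩ := h.resonance_spec hp
  obtain ⟨d', e2', e1', -⟩ := h.resonance_spec hp'
  rw [← hL] at e2'
  rw [← hS] at e1'
  set m := reducedLarge q r p
  set n := reducedSmall q r p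
  obtain ⟨-, -, -, b1, -, b2⟩ := h.snd_mem hp
  obtain ⟨-, -, -, b1', -, b2'⟩ := h.snd_mem hp'
  have hP := h.two_le
  have hc' : IsCoprime (m : ℤ) n := Nat.isCoprime_iff_coprime.2 hc
  have i₁ := h.dvd_blockValue p.2
  have i₂ := h.dvd_blockValue p'.2
  have j₁ := h.dvd_blockValue p.1
  have j₂ := h.dvd_blockValue p'.1
  rw [e2] at i₁
  rw [e2'] at i₂
  rw [e1] at j₁
  rw [e1'] at j₂
  push_cast at i₁ i₂ j₁ j₂
  have key : ∀ (k x y : ℕ), k ≤ P ^ 4 → x ≤ P → y ≤ P → |(k : ℤ) * (x - y)| ≤ (P : ℤ) ^ 5 := by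
    intro k x y hk hx hy
    have u : |(x : ℤ) - y| ≤ P := by rw [abs_le]; omega
    rw [abs_mul, Nat.abs_cast]
    calc (k : ℤ) * |(x : ℤ) - y| ≤ (P : ℤ) ^ 4 * P := by gcongr; exact_mod_cast hk
      _ = (P : ℤ) ^ 5 := by ring
  have hq : 2 * (P : ℤ) ^ 5 < q := by
    have : 2 * P ^ 5 < q := by
      calc 2 * P ^ 5 ≤ P * P ^ 5 := Nat.mul_le_mul_right _ hP
        _ = P ^ 6 := by ring
        _ < P ^ 10 := Nat.pow_lt_pow_right hP (by norm_num)
        _ ≤ q := h.pow_le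
    exact_mod_cast this
  have hlin := mul_sub_eq_mul_sub_of_dvd i₁ i₂ j₁ j₂ (key n _ _ (by omega) b2 b2')
    (key m _ _ (by omega) b1 b1') hq
  have hm0 : (0 : ℤ) < m := by omega
  have eq_of_div : ∀ {x y : ℕ}, (m : ℤ) ∣ (x : ℤ) - y → x / m = y / m → x = y := by
    intro x y hd he
    have hmod : y % m = x % m := (Nat.modEq_iff_dvd).2 hd
    rw [← Nat.div_add_mod x m, ← Nat.div_add_mod y m, he, hmod]
  have hj2 : p.2.2 = p'.2.2 := by
    refine eq_of_div (hc'.dvd_of_dvd_mul_left ?_) hj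
    exact ⟨_, hlin⟩
  have hj1 : p.1.2 = p'.1.2 := by
    rw [hj2, sub_self, mul_zero] at hlin
    have := (mul_eq_zero.1 hlin.symm).resolve_left hm0.ne'
    omega
  rw [hj2] at i₁
  rw [hj1] at j₁
  have hd : (q : ℤ) ∣ (d : ℤ) - d' := by
    refine dvd_sub_of_dvd_mul_sub h.coprime hc' ?_ ?_
    · have := dvd_sub i₁ i₂
      rwa [sub_sub_sub_cancel_right] at this
    · have := dvd_sub j₁ j₂
      rwa [sub_sub_sub_cancel_right] at this
  have hq0 : (q : ℤ) ≠ 0 := by exact_mod_cast h.pos.ne'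
  have ht2 : p.2.1 = p'.2.1 := by
    refine eq_of_div ?_ ht
    obtain ⟨k, hk⟩ := hd
    refine ⟨k, mul_left_cancel₀ hq0 ?_⟩
    unfold blockValue at e2 e2'
    rw [hj2] at e2
    zify at e2 e2'
    linear_combination e2 - e2' + (m : ℤ) * hk
  have h22 : p.2 = p'.2 := Prod.ext ht2 hj2
  have hdd : d = d' := by
    rw [h22, e2'] at e2
    exact (Nat.eq_of_mul_eq_mul_right (by omega) e2).symm
  have ht1 : p.1.1 = p'.1.1 := by
    rw [hdd, ← e1'] at e1
    unfold blockValue at e1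
    rw [hj1] at e1
    exact Nat.eq_of_mul_eq_mul_left h.pos (by omega)
  exact Prod.ext (Prod.ext ht1 hj1) h22

/-- Let m, n be the reduced numbers and t, j the parameters of the larger element. A resonance is
encoded by m, n and the quotients of t and j by m, and nonzero quotients bound t and j below. The
cases are split by which quotient vanishes. -/
theorem sum_resonances_le (h : IsResidueBlock q P a c r J) :
    ∑ p ∈ blockResonances q P r J,
      ((p.2.1 : ℝ) * p.2.2 * reducedLarge q r p)⁻¹ ≤
      recipSum P + recipSum (P ^ 4) * recipSum (P ^ 3) + 2 * recipSum P * recipSum (P ^ 3) := by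
  classical
  have hP := h.two_le
  have hP0 : (0 : ℝ) < P := by exact_mod_cast (by omega : 0 < P)
  set R := blockResonances q P r J
  set w : (ℕ × ℕ) × (ℕ × ℕ) → ℝ := fun p => ((p.2.1 : ℝ) * p.2.2 * reducedLarge q r p)⁻¹
  set R₀ := R.filter fun p => p.2.1 / reducedLarge q r p = 0
  set R₁ := R.filter fun p => ¬ p.2.1 / reducedLarge q r p = 0
  set R₂ := R₁.filter fun p => p.2.2 / reducedLarge q r p = 0
  set R₃ := R₁.filter fun p => ¬ p.2.2 / reducedLarge q r p = 0
  have split : ∑ p ∈ R, w p = ∑ p ∈ R₀, w p + ∑ p ∈ R₂, w p + ∑ p ∈ R₃, w p := by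
    rw [add_assoc, Finset.sum_filter_add_sum_filter_not, Finset.sum_filter_add_sum_filter_not]
  -- The two residue indices determine (m, n), and the t-quotient is zero, so they encode the pair.
  -- Since t > P², the factor 1/P² absorbs the P choices of the other index.
  have b₀ : ∑ p ∈ R₀, w p ≤ recipSum P := by
    have hle : ∑ p ∈ R₀, w p ≤
        ∑ b ∈ Finset.Icc 1 P ×ˢ Finset.Icc 1 P, ((P : ℝ) ^ 2)⁻¹ * (b.2 : ℝ)⁻¹ := by
      apply Finset.sum_le_sum_of_injOn_le (fun p => (p.1.2, p.2.2))
      · intro p hp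
        obtain ⟨-, -, hs⟩ := h.snd_mem (Finset.mem_filter.1 hp).1
        simp only [Finset.mem_product, Finset.mem_Icc]
        omega
      · intro p hp p' hp' he
        obtain ⟨hpR, hp0⟩ := Finset.mem_filter.1 (Finset.mem_coe.1 hp)
        obtain ⟨hpR', hp0'⟩ := Finset.mem_filter.1 (Finset.mem_coe.1 hp')
        simp only [Prod.mk.injEq] at he
        obtain ⟨hL, hS⟩ := h.reduced_eq_of_snd_eq hpR hpR' he.1 he.2
        exact h.eq_of_reduced_eq hpR hpR' hL hS (by rw [he.2]) (by rw [hp0, hL, hp0'])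
      · intro p hp
        have hpR := (Finset.mem_filter.1 hp).1
        obtain ⟨d, -, -, -, h0, hlt, -⟩ := h.resonance_spec hpR
        obtain ⟨-, -, -, -, hs, -⟩ := h.snd_mem hpR
        have hf := (fst_mem hpR).1
        have hs' : (0 : ℝ) < p.2.2 := by exact_mod_cast hs
        have hm : (1 : ℝ) ≤ reducedLarge q r p := by exact_mod_cast (by omega)
        have hf' : (P : ℝ) ^ 2 ≤ p.2.1 := by exact_mod_cast hf.le
        rw [← mul_inv]
        apply inv_anti₀ (by positivity)
        calc (P : ℝ) ^ 2 * p.2.2 = P ^ 2 * p.2.2 * 1 := (mul_one _).symm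
          _ ≤ _ := by gcongr
      · intro b _; positivity
    refine hle.trans ?_
    rw [Finset.sum_product_mul_eq (fun _ => ((P : ℝ) ^ 2)⁻¹) (fun j : ℕ => (j : ℝ)⁻¹)]
    refine mul_le_of_le_one_left (recipSum_nonneg _) ?_
    rw [Finset.sum_const, nsmul_eq_mul, Nat.card_Icc, Nat.add_sub_cancel, ← div_eq_mul_inv, div_le_one (by positivity)]
    exact le_self_pow₀ (by exact_mod_cast (by omega : 1 ≤ P)) (by norm_num)
  have inj₁ : ∀ p ∈ R₁, ∀ p' ∈ R₁, reducedLarge q r p = reducedLarge q r p' →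
      reducedSmall q r p = reducedSmall q r p' →
      p.2.2 / reducedLarge q r p = p'.2.2 / reducedLarge q r p' →
      p.2.1 / reducedLarge q r p = p'.2.1 / reducedLarge q r p' → p = p' := by
    intro p hp p' hp' hL hS h1 h2
    rw [← hL] at h1 h2
    exact h.eq_of_reduced_eq (Finset.mem_filter.1 hp).1 (Finset.mem_filter.1 hp').1 hL hS h1 h2
  -- With s the t-quotient, t ≥ sm makes the weight at most 1/(m²s). Summing over n ≤ m leaves
  -- 1/(ms).
  have b₂ : ∑ p ∈ R₂, w p ≤ recipSum (P ^ 4) * recipSum (P ^ 3) := by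
    have hle : ∑ p ∈ R₂, w p ≤
        ∑ b ∈ (Finset.Icc 1 (P ^ 4) ×ˢ Finset.Icc 1 (P ^ 4)) ×ˢ Finset.Icc 1 (P ^ 3),
          (if b.1.2 ≤ b.1.1 then ((b.1.1 : ℝ) ^ 2)⁻¹ else 0) * (b.2 : ℝ)⁻¹ := by
      apply Finset.sum_le_sum_of_injOn_le
        (fun p => ((reducedLarge q r p, reducedSmall q r p), p.2.1 / reducedLarge q r p))
      · intro p hp
        have hp1 := Finset.mem_filter.1 (Finset.mem_filter.1 hp).1
        obtain ⟨d, -, -, -, h0, hlt, hM⟩ := h.resonance_spec hp1.1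
        have hT := (Nat.div_le_self p.2.1 (reducedLarge q r p)).trans (fst_mem hp1.1).2
        simp only [Finset.mem_product, Finset.mem_Icc]
        exact ⟨⟨⟨by omega, by omega⟩, by omega, by omega⟩, Nat.pos_of_ne_zero hp1.2, hT⟩
      · intro p hp p' hp' he
        obtain ⟨hpR, hp0⟩ := Finset.mem_filter.1 (Finset.mem_coe.1 hp)
        obtain ⟨hpR', hp0'⟩ := Finset.mem_filter.1 (Finset.mem_coe.1 hp')
        simp only [Prod.mk.injEq] at he
        exact inj₁ p hpR p' hpR' he.1.1 he.1.2 (by rw [hp0, hp0']) he.2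
      · intro p hp
        have hp1 := Finset.mem_filter.1 (Finset.mem_filter.1 hp).1
        obtain ⟨d, -, -, -, h0, hlt, hM⟩ := h.resonance_spec hp1.1
        obtain ⟨-, -, -, -, hs, -⟩ := h.snd_mem hp1.1
        rw [if_pos hlt.le, ← mul_inv]
        have hs' : (1 : ℝ) ≤ p.2.2 := by exact_mod_cast hs
        have hm : (0 : ℝ) < reducedLarge q r p := by exact_mod_cast (by omega)
        have ht : (0 : ℝ) < (p.2.1 / reducedLarge q r p : ℕ) := by
          exact_mod_cast Nat.pos_of_ne_zero hp1.2
        have ht' : ((p.2.1 / reducedLarge q r p : ℕ) : ℝ) * reducedLarge q r p ≤ p.2.1 := by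
          exact_mod_cast Nat.div_mul_le_self _ _
        apply inv_anti₀ (by positivity)
        calc (reducedLarge q r p : ℝ) ^ 2 * (p.2.1 / reducedLarge q r p : ℕ)
            = ((p.2.1 / reducedLarge q r p : ℕ) * reducedLarge q r p) * 1 * reducedLarge q r p := by
              ring
          _ ≤ _ := by gcongr
      · intro b _
        split_ifs <;> positivity
    refine hle.trans ?_
    rw [Finset.sum_product_mul_eq
      (fun b : ℕ × ℕ => if b.2 ≤ b.1 then ((b.1 : ℝ) ^ 2)⁻¹ else 0) (fun s : ℕ => (s : ℝ)⁻¹),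
      Finset.sum_product]
    refine mul_le_mul_of_nonneg_right ?_ (recipSum_nonneg _)
    refine (sum_sum_ite_le_le (P ^ 4) (fun m => ((m : ℝ) ^ 2)⁻¹) fun m => by positivity).trans ?_
    refine Finset.sum_le_sum fun m hm => ?_
    have : (0 : ℝ) < m := by exact_mod_cast (Finset.mem_Icc.1 hm).1
    apply le_of_eq
    field_simp
  -- Both quotients now save a factor m, so after summing over n the sum in m is of 1/m², at most 2.
  have b₃ : ∑ p ∈ R₃, w p ≤ 2 * recipSum P * recipSum (P ^ 3) := by
    have hle : ∑ p ∈ R₃, w p ≤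
        ∑ b ∈ (Finset.Icc 1 (P ^ 4) ×ˢ Finset.Icc 1 (P ^ 4)) ×ˢ
            (Finset.Icc 1 P ×ˢ Finset.Icc 1 (P ^ 3)),
          (if b.1.2 ≤ b.1.1 then ((b.1.1 : ℝ) ^ 3)⁻¹ else 0) *
            ((b.2.1 : ℝ)⁻¹ * (b.2.2 : ℝ)⁻¹) := by
      apply Finset.sum_le_sum_of_injOn_le
        (fun p => ((reducedLarge q r p, reducedSmall q r p),
          (p.2.2 / reducedLarge q r p, p.2.1 / reducedLarge q r p)))
      · intro p hp
        have hp0 := (Finset.mem_filter.1 hp).2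
        have hp1 := Finset.mem_filter.1 (Finset.mem_filter.1 hp).1
        obtain ⟨d, -, -, -, h0, hlt, hM⟩ := h.resonance_spec hp1.1
        obtain ⟨-, -, -, -, -, hs⟩ := h.snd_mem hp1.1
        have hT := (Nat.div_le_self p.2.1 (reducedLarge q r p)).trans (fst_mem hp1.1).2
        have hJ := (Nat.div_le_self p.2.2 (reducedLarge q r p)).trans hs
        simp only [Finset.mem_product, Finset.mem_Icc]
        exact ⟨⟨⟨by omega, by omega⟩, by omega, by omega⟩,
          ⟨Nat.pos_of_ne_zero hp0, hJ⟩, Nat.pos_of_ne_zero hp1.2, hT⟩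
      · intro p hp p' hp' he
        obtain ⟨hpR, -⟩ := Finset.mem_filter.1 (Finset.mem_coe.1 hp)
        obtain ⟨hpR', -⟩ := Finset.mem_filter.1 (Finset.mem_coe.1 hp')
        simp only [Prod.mk.injEq] at he
        exact inj₁ p hpR p' hpR' he.1.1 he.1.2 he.2.1 he.2.2
      · intro p hp
        have hp0 := (Finset.mem_filter.1 hp).2
        have hp1 := Finset.mem_filter.1 (Finset.mem_filter.1 hp).1
        obtain ⟨d, -, -, -, h0, hlt, hM⟩ := h.resonance_spec hp1.1
        rw [if_pos hlt.le, ← mul_inv, ← mul_inv]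
        have hm : (0 : ℝ) < reducedLarge q r p := by exact_mod_cast (by omega)
        have ht : (0 : ℝ) < (p.2.1 / reducedLarge q r p : ℕ) := by
          exact_mod_cast Nat.pos_of_ne_zero hp1.2
        have hj : (0 : ℝ) < (p.2.2 / reducedLarge q r p : ℕ) := by
          exact_mod_cast Nat.pos_of_ne_zero hp0
        have ht' : ((p.2.1 / reducedLarge q r p : ℕ) : ℝ) * reducedLarge q r p ≤ p.2.1 := by
          exact_mod_cast Nat.div_mul_le_self _ _
        have hj' : ((p.2.2 / reducedLarge q r p : ℕ) : ℝ) * reducedLarge q r p ≤ p.2.2 := by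
          exact_mod_cast Nat.div_mul_le_self _ _
        apply inv_anti₀ (by positivity)
        calc (reducedLarge q r p : ℝ) ^ 3 *
              ((p.2.2 / reducedLarge q r p : ℕ) * (p.2.1 / reducedLarge q r p : ℕ))
            = ((p.2.1 / reducedLarge q r p : ℕ) * reducedLarge q r p) *
              ((p.2.2 / reducedLarge q r p : ℕ) * reducedLarge q r p) * reducedLarge q r p := by
              ring
          _ ≤ _ := by gcongr
      · intro b _
        split_ifs <;> positivity
    refine hle.trans ?_
    rw [Finset.sum_product_mul_eq
      (fun b : ℕ × ℕ => if b.2 ≤ b.1 then ((b.1 : ℝ) ^ 3)⁻¹ else 0)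
      (fun s : ℕ × ℕ => (s.1 : ℝ)⁻¹ * (s.2 : ℝ)⁻¹), Finset.sum_product,
      Finset.sum_product_mul_eq (fun x : ℕ => (x : ℝ)⁻¹) (fun y : ℕ => (y : ℝ)⁻¹), mul_assoc]
    refine mul_le_mul_of_nonneg_right ?_ (mul_nonneg (recipSum_nonneg _) (recipSum_nonneg _))
    refine (sum_sum_ite_le_le (P ^ 4) (fun m => ((m : ℝ) ^ 3)⁻¹) fun m => by positivity).trans ?_
    refine le_trans (Finset.sum_le_sum fun m hm => ?_) (sum_inv_sq_le_two (P ^ 4))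
    have : (0 : ℝ) < m := by exact_mod_cast (Finset.mem_Icc.1 hm).1
    apply le_of_eq
    field_simp
  rw [split]
  linarith

end IsResidueBlock

/-! ### Variance estimate on a residue block. -/

namespace IsResidueBlock

variable {q P : ℕ} {a c : ℤ} {r : ℕ → ℕ} {J : Finset ℕ}

theorem mem_blockIndex (h : IsResidueBlock q P a c r J) {i : ℕ × ℕ} (hi : i ∈ blockIndex P J) :
    P ^ 2 < i.1 ∧ i.1 ≤ P ^ 3 ∧ 1 ≤ i.2 ∧ i.2 ≤ P := by
  simp only [blockIndex, Finset.mem_product, Finset.mem_Ioc] at hi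
  have := Finset.mem_Icc.1 (h.subset hi.2)
  exact ⟨hi.1.1, hi.1.2, this.1, this.2⟩

theorem blockValue_pos (h : IsResidueBlock q P a c r J) {i : ℕ × ℕ} (hi : i ∈ blockIndex P J) :
    0 < blockValue q r i := by
  have := Nat.mul_pos h.pos (lt_of_le_of_lt (Nat.zero_le _) (h.mem_blockIndex hi).1)
  unfold blockValue
  omega

theorem blockValue_injOn (h : IsResidueBlock q P a c r J) :
    Set.InjOn (blockValue q r) (blockIndex P J) := by
  intro x hx y hy he
  obtain ⟨-, -, -, bx⟩ := h.mem_blockIndex hx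
  obtain ⟨-, -, -, hyP⟩ := h.mem_blockIndex hy
  have hd := dvd_sub (h.dvd_blockValue x) (h.dvd_blockValue y)
  rw [he, sub_sub_sub_cancel_left, add_sub_add_left_eq_sub] at hd
  have hPq : P < q := by
    calc P = P ^ 1 := (pow_one P).symm
      _ < P ^ 10 := Nat.pow_lt_pow_right h.two_le (by norm_num)
      _ ≤ q := h.pow_le
  have h2 := Int.eq_zero_of_abs_lt_dvd hd (by rw [abs_lt]; omega)
  have h2' : x.2 = y.2 := by omega
  unfold blockValue at he
  rw [h2'] at he
  exact Prod.ext (Nat.eq_of_mul_eq_mul_left h.pos (by omega)) h2'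

theorem sum_inv_blockIndex_eq (P : ℕ) (J : Finset ℕ) :
    ∑ i ∈ blockIndex P J, ((i.1 : ℝ) * i.2)⁻¹ =
      (∑ t ∈ Finset.Ioc (P ^ 2) (P ^ 3), (t : ℝ)⁻¹) * ∑ j ∈ J, (j : ℝ)⁻¹ := by
  simp only [mul_inv]
  exact Finset.sum_product_mul_eq (fun t : ℕ => (t : ℝ)⁻¹) (fun j : ℕ => (j : ℝ)⁻¹)

theorem sum_inv_blockIndex_le (h : IsResidueBlock q P a c r J) :
    ∑ i ∈ blockIndex P J, ((i.1 : ℝ) * i.2)⁻¹ ≤ recipSum P * recipSum (P ^ 3) := by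
  rw [sum_inv_blockIndex_eq, mul_comm]
  refine mul_le_mul ?_ ?_ (Finset.sum_nonneg fun _ _ => by positivity) (recipSum_nonneg _)
  · exact Finset.sum_le_sum_of_subset_of_nonneg h.subset fun _ _ _ => by positivity
  · refine Finset.sum_le_sum_of_subset_of_nonneg ?_ fun _ _ _ => by positivity
    intro t ht
    simp only [Finset.mem_Ioc, Finset.mem_Icc] at ht ⊢
    omega

/-- The contribution of the pair `x, y` to the correlation sum, when `y` gives the larger number. -/
noncomputable def gcdWeight (q : ℕ) (r : ℕ → ℕ) (x y : ℕ × ℕ) : ℝ :=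
  if blockValue q r x < blockValue q r y then
    ((y.1 : ℝ) * y.2)⁻¹ * ((blockValue q r x).gcd (blockValue q r y) / blockValue q r y) else 0

theorem gcdWeight_nonneg (x y : ℕ × ℕ) : 0 ≤ gcdWeight q r x y := by
  unfold gcdWeight
  split_ifs <;> positivity

/-- A nonresonant pair contributes at most P⁻⁴/(tj), and the block has at most P⁴ elements to serve
as its smaller member. The remaining pairs are resonances. -/
theorem sum_gcdWeight_le (h : IsResidueBlock q P a c r J) :
    ∑ x ∈ blockIndex P J, ∑ y ∈ blockIndex P J, gcdWeight q r x y ≤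
      recipSum P * recipSum (P ^ 3) + (recipSum P + recipSum (P ^ 4) * recipSum (P ^ 3) +
        2 * recipSum P * recipSum (P ^ 3)) := by
  classical
  have hP0 : (0 : ℝ) < P := by exact_mod_cast (by have := h.two_le; omega : 0 < P)
  set S := blockIndex P J
  have hpt : ∀ p ∈ S ×ˢ S, gcdWeight q r p.1 p.2 ≤
      ((P : ℝ) ^ 4)⁻¹ * ((p.2.1 : ℝ) * p.2.2)⁻¹ +
      if p ∈ blockResonances q P r J then ((p.2.1 : ℝ) * p.2.2 * reducedLarge q r p)⁻¹ else 0 := by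
    intro p hp
    obtain ⟨hp1, hp2⟩ := Finset.mem_product.1 hp
    have hn : 0 ≤ if p ∈ blockResonances q P r J then
        ((p.2.1 : ℝ) * p.2.2 * reducedLarge q r p)⁻¹ else 0 := by split_ifs <;> positivity
    unfold gcdWeight
    split_ifs with hlt hR hR
    · have hy := h.blockValue_pos hp2
      have hd0 : 0 < (blockValue q r p.1).gcd (blockValue q r p.2) := Nat.gcd_pos_of_pos_right _ hy
      have e : (blockValue q r p.2 : ℝ) =
          (blockValue q r p.1).gcd (blockValue q r p.2) * reducedLarge q r p := by
        exact_mod_cast (Nat.mul_div_cancel' (Nat.gcd_dvd_right _ _)).symm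
      have hg : ((blockValue q r p.1).gcd (blockValue q r p.2) : ℝ) / blockValue q r p.2 =
          (reducedLarge q r p : ℝ)⁻¹ := by
        have hd0' : ((blockValue q r p.1).gcd (blockValue q r p.2) : ℝ) ≠ 0 := by
          exact_mod_cast hd0.ne'
        conv_lhs => rw [e]
        rw [div_mul_eq_div_div, div_self hd0', one_div]
      rw [hg, ← mul_inv (_ * _)]
      have : 0 ≤ ((P : ℝ) ^ 4)⁻¹ * ((p.2.1 : ℝ) * p.2.2)⁻¹ := by positivity
      linarith
    · have hy := h.blockValue_pos hp2
      have hL : P ^ 4 ≤ reducedLarge q r p := by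
        by_contra hc
        exact hR (Finset.mem_filter.2 ⟨hp, hlt, not_le.1 hc⟩)
      have hle : P ^ 4 * (blockValue q r p.1).gcd (blockValue q r p.2) ≤ blockValue q r p.2 := by
        calc _ ≤ reducedLarge q r p * (blockValue q r p.1).gcd (blockValue q r p.2) :=
              Nat.mul_le_mul_right _ hL
          _ = _ := Nat.div_mul_cancel (Nat.gcd_dvd_right _ _)
      have hle' : (P : ℝ) ^ 4 * (blockValue q r p.1).gcd (blockValue q r p.2) ≤
          blockValue q r p.2 := by exact_mod_cast hle
      have hy' : (0 : ℝ) < blockValue q r p.2 := by exact_mod_cast hy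
      rw [add_zero, mul_comm]
      gcongr
      rw [div_le_iff₀ hy', ← div_eq_inv_mul, le_div_iff₀ (by positivity)]
      linarith
    · positivity
    · positivity
  rw [← Finset.sum_product' S S fun x y => gcdWeight q r x y]
  refine (Finset.sum_le_sum hpt).trans ?_
  rw [Finset.sum_add_distrib, ← Finset.sum_filter]
  refine add_le_add ?_ ?_
  · rw [Finset.sum_product_mul_eq (fun _ => ((P : ℝ) ^ 4)⁻¹)
      (fun y : ℕ × ℕ => ((y.1 : ℝ) * y.2)⁻¹), Finset.sum_const, nsmul_eq_mul]
    refine le_trans (mul_le_of_le_one_left (Finset.sum_nonneg fun _ _ => by positivity) ?_)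
      h.sum_inv_blockIndex_le
    rw [← div_eq_mul_inv, div_le_one (by positivity)]
    have : S.card ≤ P ^ 4 := by
      calc S.card = (P ^ 3 - P ^ 2) * J.card := by
            simp only [S, blockIndex, Finset.card_product, Nat.card_Ioc]
        _ ≤ P ^ 3 * P := Nat.mul_le_mul (Nat.sub_le _ _)
            ((Finset.card_le_card h.subset).trans (by simp))
        _ = P ^ 4 := by ring
    exact_mod_cast this
  · refine le_trans (Finset.sum_le_sum_of_subset_of_nonneg ?_ fun _ _ _ => by positivity)
      h.sum_resonances_le
    intro p hp
    exact (Finset.mem_filter.1 hp).2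

theorem measure_avoid_mul_sq_le (h : IsResidueBlock q P a c r J) (γ : UnitAddCircle) {b : ℝ}
    (hb : 0 < b) (hbP : 2 * b ≤ P ^ 2) :
    volume.real (⋂ i ∈ blockIndex P J,
        (nearMultiples γ (blockValue q r i) (b * ((i.1 : ℝ) * i.2)⁻¹))ᶜ) *
      (2 * b * ∑ i ∈ blockIndex P J, ((i.1 : ℝ) * i.2)⁻¹) ^ 2 ≤
    2 * b * ∑ i ∈ blockIndex P J, ((i.1 : ℝ) * i.2)⁻¹ +
      4 * b * ∑ x ∈ blockIndex P J, ∑ y ∈ blockIndex P J, gcdWeight q r x y := by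
  classical
  set S := blockIndex P J
  set ψ : ℕ × ℕ → ℝ := fun i => b * ((i.1 : ℝ) * i.2)⁻¹ with hψ
  set A : ℕ × ℕ → Set UnitAddCircle := fun i => nearMultiples γ (blockValue q r i) (ψ i) with hA
  have hψ0 : ∀ i, 0 ≤ ψ i := fun i => by positivity
  have hμ : ∀ i ∈ S, volume.real (A i) = 2 * ψ i := by
    intro i hi
    obtain ⟨h1, -, h2, -⟩ := h.mem_blockIndex hi
    have h1' : (P : ℝ) ^ 2 < i.1 := by exact_mod_cast h1
    have h2' : (1 : ℝ) ≤ i.2 := by exact_mod_cast h2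
    have hpos : (0 : ℝ) < i.1 := by linarith
    have hle : 2 * ψ i ≤ 1 := by
      simp only [hψ]
      rw [← mul_assoc, ← div_eq_mul_inv, div_le_one (by positivity)]
      nlinarith
    rw [measureReal_def, measure_nearMultiples γ (h.blockValue_pos hi), min_eq_right hle,
      ENNReal.toReal_ofReal (by have := hψ0 i; positivity)]
  have hcorr : ∀ x ∈ S, ∀ y ∈ S,
      volume.real (A x ∩ A y) - volume.real (A x) * volume.real (A y) ≤
        (if x = y then 2 * ψ x else 0) +
          (2 * b * gcdWeight q r x y + 2 * b * gcdWeight q r y x) := by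
    -- The main term of the correlation bound cancels the product of the measures exactly. Only the
    -- gcd term, over the larger number, survives.
    have hlt : ∀ x ∈ S, ∀ y ∈ S, blockValue q r x < blockValue q r y →
        volume.real (A x ∩ A y) - volume.real (A x) * volume.real (A y) ≤
          2 * b * gcdWeight q r x y := by
      intro x hx y hy hxy
      have := measureReal_nearMultiples_inter_le γ (n := blockValue q r x) (h.blockValue_pos hy)
        (hψ0 x) (hψ0 y)
      rw [hμ x hx, hμ y hy, gcdWeight, if_pos hxy]
      refine (sub_le_sub_right this _).trans (le_of_eq ?_)
      simp only [hψ]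
      ring
    intro x hx y hy
    have g1 := mul_nonneg (mul_nonneg zero_le_two hb.le) (gcdWeight_nonneg (q := q) (r := r) x y)
    have g2 := mul_nonneg (mul_nonneg zero_le_two hb.le) (gcdWeight_nonneg (q := q) (r := r) y x)
    by_cases hxy : x = y
    · subst hxy
      rw [if_pos rfl, Set.inter_self, hμ x hx]
      nlinarith [hψ0 x]
    · rw [if_neg hxy]
      rcases lt_or_gt_of_ne (fun e => hxy (h.blockValue_injOn hx hy e)) with hl | hl
      · linarith [hlt x hx y hy hl]
      · have := hlt y hy x hx hl
        rw [Set.inter_comm, mul_comm (volume.real (A y))] at this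
        linarith
  have : IsProbabilityMeasure (volume : Measure UnitAddCircle) := ⟨UnitAddCircle.measure_univ⟩
  have hmain := measureReal_compl_mul_sum_sq_le volume S A
    (fun i => measurableSet_nearMultiples _ _ _)
  rw [Finset.sum_congr rfl hμ] at hmain
  have e1 : ∑ i ∈ S, 2 * ψ i = 2 * b * ∑ i ∈ S, ((i.1 : ℝ) * i.2)⁻¹ := by
    rw [Finset.mul_sum]
    exact Finset.sum_congr rfl fun i _ => by simp only [hψ]; ring
  have e2 : ∑ x ∈ S, ∑ y ∈ S, ((if x = y then 2 * ψ x else 0) +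
      (2 * b * gcdWeight q r x y + 2 * b * gcdWeight q r y x)) =
      2 * b * ∑ i ∈ S, ((i.1 : ℝ) * i.2)⁻¹ +
        4 * b * ∑ x ∈ S, ∑ y ∈ S, gcdWeight q r x y := by
    simp only [Finset.sum_add_distrib, ← Finset.mul_sum]
    rw [Finset.sum_comm (f := fun x y => gcdWeight q r y x), ← e1]
    have : ∑ x ∈ S, ∑ y ∈ S, (if x = y then 2 * ψ x else 0) = ∑ x ∈ S, 2 * ψ x := by
      refine Finset.sum_congr rfl fun x hx => ?_
      rw [Finset.sum_ite_eq, if_pos hx]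
    rw [this]
    ring
  rw [e1] at hmain
  refine hmain.trans ?_
  rw [← e2]
  exact Finset.sum_le_sum fun x hx => Finset.sum_le_sum fun y hy => hcorr x hx y hy

theorem measure_avoid_le (h : IsResidueBlock q P a c r J) (γ : UnitAddCircle) {b : ℝ}
    (hb : 0 < b) (hbP : 2 * b ≤ P ^ 2) (hlog : 2 ≤ Real.log P)
    (hJ : recipSum P - 1 ≤ ∑ j ∈ J, (j : ℝ)⁻¹) :
    volume.real (⋂ i ∈ blockIndex P J,
        (nearMultiples γ (blockValue q r i) (b * ((i.1 : ℝ) * i.2)⁻¹))ᶜ) ≤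
      800 / (b * Real.log P ^ 2) := by
  have hmain := h.measure_avoid_mul_sq_le γ hb hbP
  have hP0 : 0 < P := by have := h.two_le; omega
  have h1 := recipSum_le P
  have h3 := recipSum_le (P ^ 3)
  have h4 := recipSum_le (P ^ 4)
  have h2 := recipSum_le (P ^ 2)
  have l1 := log_le_recipSum hP0
  have l3 := log_le_recipSum (pow_pos hP0 3)
  simp only [Nat.cast_pow, Real.log_pow, Nat.cast_ofNat] at h2 h3 h4 l3
  set l := Real.log P
  have n1 := recipSum_nonneg P
  have n3 := recipSum_nonneg (P ^ 3)
  have u1 : recipSum P * recipSum (P ^ 3) ≤ 2 * l * (4 * l) :=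
    mul_le_mul (by linarith) (by linarith) n3 (by linarith)
  have u2 : recipSum (P ^ 4) * recipSum (P ^ 3) ≤ 5 * l * (4 * l) :=
    mul_le_mul (by linarith) (by linarith) n3 (by linarith)
  have hG := h.sum_gcdWeight_le
  have hS := h.sum_inv_blockIndex_le
  have hT : recipSum (P ^ 3) - recipSum (P ^ 2) =
      ∑ t ∈ Finset.Ioc (P ^ 2) (P ^ 3), (t : ℝ)⁻¹ := by
    rw [sub_eq_iff_eq_add']
    unfold recipSum
    rw [← Finset.sum_union]
    · congr 1
      have := Nat.pow_le_pow_right hP0 (by norm_num : 2 ≤ 3)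
      ext t
      simp only [Finset.mem_union, Finset.mem_Icc, Finset.mem_Ioc]
      omega
    · rw [Finset.disjoint_left]
      intro t
      simp only [Finset.mem_Icc, Finset.mem_Ioc]
      omega
  -- The t-sum is at least 3l - (1 + 2l) and the j-sum at least l - 1; both are at least l/2 since l
  -- ≥ 2.
  have hSl : l / 2 * (l / 2) ≤ ∑ i ∈ blockIndex P J, ((i.1 : ℝ) * i.2)⁻¹ := by
    rw [sum_inv_blockIndex_eq, ← hT]
    exact mul_le_mul (by linarith) (by linarith) (by linarith) (by linarith)
  set σ := ∑ i ∈ blockIndex P J, ((i.1 : ℝ) * i.2)⁻¹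
  set G := ∑ x ∈ blockIndex P J, ∑ y ∈ blockIndex P J, gcdWeight q r x y
  set V := volume.real (⋂ i ∈ blockIndex P J,
        (nearMultiples γ (blockValue q r i) (b * ((i.1 : ℝ) * i.2)⁻¹))ᶜ)
  have hV : 0 ≤ V := measureReal_nonneg
  have hG' : G ≤ 46 * l ^ 2 := by nlinarith
  have hS' : σ ≤ 8 * l ^ 2 := by nlinarith
  have hup : 2 * b * σ + 4 * b * G ≤ b * (200 * l ^ 2) := by nlinarith
  have hlow : b ^ 2 * l ^ 4 / 4 ≤ (2 * b * σ) ^ 2 := by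
    have : b * l ^ 2 / 2 ≤ 2 * b * σ := by nlinarith
    calc b ^ 2 * l ^ 4 / 4 = (b * l ^ 2 / 2) ^ 2 := by ring
      _ ≤ _ := pow_le_pow_left₀ (by positivity) this 2
  have hl2 : 0 < b * l ^ 2 := by positivity
  have hfin : V * (b ^ 2 * l ^ 4 / 4) ≤ b * (200 * l ^ 2) :=
    (mul_le_mul_of_nonneg_left hlow hV).trans (hmain.trans hup)
  rw [le_div_iff₀ hl2]
  have : V * (b * l ^ 2) * (b * l ^ 2) ≤ 800 * (b * l ^ 2) := by nlinarith
  exact le_of_mul_le_mul_right this hl2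

end IsResidueBlock

/-! ### Existence of residue blocks. -/

/-- Among the residues `c + 1, …, c + P`, at most one is annihilated by a small factor. -/
theorem exists_isResidueBlock {q P : ℕ} {a : ℤ} (c : ℤ) (ha : IsCoprime a q) (hP : 2 ≤ P)
    (hq : P ^ 10 ≤ q) : ∃ (r : ℕ → ℕ) (J : Finset ℕ), IsResidueBlock q P a c r J ∧
      (∀ j, r j < q) ∧ recipSum P - 1 ≤ ∑ j ∈ J, (j : ℝ)⁻¹ := by
  classical
  have hq0 : 0 < q := lt_of_lt_of_le (pow_pos (by omega) _) hq
  obtain ⟨u, v, huv⟩ := ha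
  set good : ℕ → Prop := fun j => ∀ k : ℕ, 0 < k → k < P ^ 4 → ¬ (q : ℤ) ∣ k * (c + j) with hgood
  have hr0 : ∀ j : ℕ, 0 ≤ (u * (c + j)) % (q : ℤ) := fun j => Int.emod_nonneg _ (by omega)
  refine ⟨fun j => ((u * (c + j)) % (q : ℤ)).toNat, (Finset.Icc 1 P).filter good,
    ⟨⟨u, v, huv⟩, hP, hq, ?_, Finset.filter_subset _ _, ?_⟩, ?_, ?_⟩
  · intro j
    rw [Int.toNat_of_nonneg (hr0 j), Int.emod_def]
    exact ⟨-(v * (c + j)) - a * (u * (c + j) / q), by linear_combination (c + j : ℤ) * huv⟩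
  · intro j hj
    exact (Finset.mem_filter.1 hj).2
  · intro j
    have := Int.emod_lt_of_pos (u * (c + j)) (by exact_mod_cast hq0 : (0 : ℤ) < q)
    have := hr0 j
    dsimp only
    omega
  · rw [sub_le_iff_le_add, recipSum, ← Finset.sum_filter_add_sum_filter_not (Finset.Icc 1 P) good]
    gcongr
    -- Two bad indices x, y with factors k, m make q divide km(x - y), which is smaller than q in
    -- absolute value because P⁹ < q. So x = y.
    have hcard : ((Finset.Icc 1 P).filter fun j => ¬ good j).card ≤ 1 := by
      rw [Finset.card_le_one]
      intro x hx y hy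
      simp only [Finset.mem_filter, Finset.mem_Icc, hgood, not_forall, not_not] at hx hy
      obtain ⟨hx1, k, hk, hkP, hkd⟩ := hx
      obtain ⟨hy1, m, hm, hmP, hmd⟩ := hy
      have hd : (q : ℤ) ∣ k * m * ((x : ℤ) - y) := by
        obtain ⟨s, hs⟩ := hkd
        obtain ⟨t, ht⟩ := hmd
        exact ⟨m * s - k * t, by linear_combination (m : ℤ) * hs - (k : ℤ) * ht⟩
      have hlt : |(k * m * ((x : ℤ) - y) : ℤ)| < q := by
        have h1 : |((x : ℤ) - y)| ≤ P := by rw [abs_le]; omega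
        have h2 : P ^ 4 * P ^ 4 * P < q := by
          calc P ^ 4 * P ^ 4 * P = P ^ 9 := by ring
            _ < P ^ 10 := Nat.pow_lt_pow_right hP (by norm_num)
            _ ≤ q := hq
        rw [abs_mul, abs_of_nonneg (by positivity : (0 : ℤ) ≤ k * m)]
        have h3 : (k : ℤ) ≤ (P : ℤ) ^ 4 := by exact_mod_cast hkP.le
        have h4 : (m : ℤ) ≤ (P : ℤ) ^ 4 := by exact_mod_cast hmP.le
        calc (k : ℤ) * m * |(x : ℤ) - y| ≤ (P : ℤ) ^ 4 * (P : ℤ) ^ 4 * P := by gcongr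
          _ < q := by exact_mod_cast h2
      have h0 := Int.eq_zero_of_abs_lt_dvd hd hlt
      rcases mul_eq_zero.1 h0 with h | h
      · rcases mul_eq_zero.1 h with h | h <;> omega
      · omega
    calc ∑ j ∈ (Finset.Icc 1 P).filter (fun j => ¬ good j), (j : ℝ)⁻¹
        ≤ ∑ j ∈ (Finset.Icc 1 P).filter (fun j => ¬ good j), (1 : ℝ) := by
          refine Finset.sum_le_sum fun j hj => inv_le_one_of_one_le₀ ?_
          exact_mod_cast (Finset.mem_Icc.1 (Finset.mem_filter.1 hj).1).1
      _ ≤ 1 := by simpa using hcard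

/-! ### Liouville approximations and the size of the first factor. -/

theorem distNearestInt_nonneg (x : ℝ) : 0 ≤ distNearestInt x := abs_nonneg _

theorem distNearestInt_eq_norm (x : ℝ) : distNearestInt x = ‖(x : UnitAddCircle)‖ :=
  UnitAddCircle.norm_eq.symm

theorem distNearestInt_le (x : ℝ) (z : ℤ) : distNearestInt x ≤ |x - z| := round_le x z

/-- Reducing a fraction only weakens the required bound, but may shrink its denominator.
Irrationality keeps x away from all fractions of denominator at most B, so a sufficiently good
approximation has a large reduced denominator. -/
theorem Liouville.exists_isCoprime_abs_sub_lt {x : ℝ} (hx : Liouville x) (k B : ℕ) :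
    ∃ (a : ℤ) (q : ℕ), B ≤ q ∧ IsCoprime a q ∧ |x - a / q| < 1 / (q : ℝ) ^ k := by
  have h1 := hx.irrational.eventually_forall_le_dist_cast_rat_of_den_le B
  have h2 : Tendsto (fun n : ℕ => (1 / 2 : ℝ) ^ n) atTop (𝓝 0) :=
    tendsto_pow_atTop_nhds_zero_of_lt_one (by norm_num) (by norm_num)
  obtain ⟨n, hn, hnk⟩ := ((h2.eventually h1).and (eventually_ge_atTop k)).exists
  obtain ⟨a, b, hb, -, hlt⟩ := hx n
  set ρ : ℚ := (a : ℚ) / b with hρ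
  have hρR : (ρ : ℝ) = a / b := by rw [hρ]; push_cast; rfl
  have hbR : (2 : ℝ) ≤ b := by exact_mod_cast hb
  have hden : (ρ.den : ℤ) ≤ b := by
    refine Int.le_of_dvd (by omega) ?_
    rw [hρ, ← Rat.divInt_eq_div]
    exact Rat.den_dvd a b
  have hdenR : (ρ.den : ℝ) ≤ b := by exact_mod_cast hden
  have hpos : (0 : ℝ) < ρ.den := by exact_mod_cast ρ.den_pos
  have hbig : B < ρ.den := by
    by_contra hle
    have h3 := hn ρ (not_lt.1 hle)
    rw [Real.dist_eq, hρR] at h3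
    have : (1 : ℝ) / (b : ℝ) ^ n ≤ (1 / 2) ^ n := by
      rw [one_div_pow]
      gcongr
    linarith
  refine ⟨ρ.num, ρ.den, hbig.le, Rat.isCoprime_num_den ρ, ?_⟩
  rw [← Rat.cast_def, hρR]
  refine hlt.trans_le ?_
  have h4 : (1 : ℝ) ≤ b := by linarith
  calc (1 : ℝ) / (b : ℝ) ^ n ≤ 1 / (b : ℝ) ^ k := by gcongr
    _ ≤ 1 / (ρ.den : ℝ) ^ k := by gcongr

/-- The lower bound on q makes the congruences rigid; the upper bound keeps log q comparable to log
P. -/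
theorem exists_pow_ten_bracket (P₀ q : ℕ) (h : P₀ ^ 10 ≤ q) :
    ∃ P, P₀ ≤ P ∧ P ^ 10 ≤ q ∧ q < (P + 1) ^ 10 := by
  have hP : ∀ k, k ≤ k ^ 10 := fun k => Nat.le_self_pow (by norm_num) k
  refine ⟨Nat.findGreatest (fun k => k ^ 10 ≤ q) q, ?_, ?_, ?_⟩
  · exact Nat.le_findGreatest ((hP P₀).trans h) h
  · exact Nat.findGreatest_spec (P := fun k => k ^ 10 ≤ q) ((hP P₀).trans h) h
  · by_contra hle
    have h1 := not_lt.1 hle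
    have := Nat.le_findGreatest (P := fun k => k ^ 10 ≤ q) ((hP _).trans h1) h1
    omega

/-- The factor `n (log n)² ‖n α - γ‖`. -/
noncomputable def liouvilleFactor (α γ : ℝ) (n : ℕ) : ℝ :=
  (n : ℝ) * Real.log n ^ 2 * distNearestInt (n * α - γ)

/-- The approximation rate `1 / (n (log n)² ‖n α - γ‖)`, truncated at `1`. -/
noncomputable def approxRate (α γ : ℝ) (n : ℕ) : ℝ := (max 1 (liouvilleFactor α γ n))⁻¹

theorem liouvilleFactor_nonneg (α γ : ℝ) (n : ℕ) : 0 ≤ liouvilleFactor α γ n :=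
  mul_nonneg (by positivity) (distNearestInt_nonneg _)

theorem approxRate_nonneg (α γ : ℝ) (n : ℕ) : 0 ≤ approxRate α γ n :=
  inv_nonneg.2 (zero_le_one.trans (le_max_left _ _))

theorem approxRate_le_one (α γ : ℝ) (n : ℕ) : approxRate α γ n ≤ 1 :=
  inv_le_one_of_one_le₀ (le_max_left _ _)

theorem IsResidueBlock.liouvilleFactor_le {q P : ℕ} {a : ℤ} {r : ℕ → ℕ} {J : Finset ℕ} {α γ : ℝ}
    (h : IsResidueBlock q P a ⌈γ * q⌉ r J) (hr : ∀ j, r j < q) (hα : |α - a / q| < 1 / (q : ℝ) ^ 3)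
    (hq : q < (P + 1) ^ 10) {i : ℕ × ℕ} (hi : i ∈ blockIndex P J) :
    liouvilleFactor α γ (blockValue q r i) ≤ 9600 * ((i.1 : ℝ) * i.2 * Real.log P ^ 2) := by
  obtain ⟨t1, t2, j1, j2⟩ := h.mem_blockIndex hi
  have hP := h.two_le
  have hq0 : (0 : ℝ) < q := by exact_mod_cast h.pos
  have hn0 : (0 : ℝ) < blockValue q r i := by exact_mod_cast h.blockValue_pos hi
  have ht : 1 ≤ i.1 := by omega
  have htq : i.1 + 1 ≤ q := by
    calc i.1 + 1 ≤ P ^ 3 + 1 := by omega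
      _ ≤ P ^ 10 := Nat.pow_lt_pow_right hP (by norm_num)
      _ ≤ q := h.pow_le
  have hn1 : blockValue q r i ≤ q * (i.1 + 1) := by
    have := hr i.2
    unfold blockValue
    rw [Nat.mul_add]
    omega
  have hn2 : (blockValue q r i : ℝ) ≤ 2 * q * i.1 := by
    have : blockValue q r i ≤ 2 * q * i.1 := by
      calc _ ≤ q * (i.1 + 1) := hn1
        _ ≤ q * (2 * i.1) := Nat.mul_le_mul_left _ (by omega)
        _ = _ := by ring
    exact_mod_cast this
  have hn3 : (blockValue q r i : ℝ) ≤ (q : ℝ) ^ 2 := by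
    have : blockValue q r i ≤ q ^ 2 := by
      calc _ ≤ q * (i.1 + 1) := hn1
        _ ≤ q * q := Nat.mul_le_mul_left _ htq
        _ = _ := by ring
    exact_mod_cast this
  have hlog : Real.log (blockValue q r i) ≤ 40 * Real.log P := by
    have hPP : q ≤ P ^ 20 := by
      calc q ≤ (P + 1) ^ 10 := hq.le
        _ ≤ (P ^ 2) ^ 10 := Nat.pow_le_pow_left (by nlinarith) _
        _ = P ^ 20 := by ring
    have h2 : (q : ℝ) ≤ (P : ℝ) ^ 20 := by exact_mod_cast hPP
    calc Real.log (blockValue q r i) ≤ Real.log ((q : ℝ) ^ 2) := Real.log_le_log hn0 hn3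
      _ = 2 * Real.log q := by rw [Real.log_pow]; norm_num
      _ ≤ 2 * Real.log ((P : ℝ) ^ 20) := by gcongr
      _ = 40 * Real.log P := by rw [Real.log_pow]; push_cast; ring
  have hlog0 : 0 ≤ Real.log (blockValue q r i) := Real.log_natCast_nonneg _
  have hdist : distNearestInt (blockValue q r i * α - γ) ≤ 3 * i.2 / q := by
    obtain ⟨z, hz⟩ := h.dvd_blockValue i
    have hzR : (a : ℝ) * blockValue q r i - (⌈γ * q⌉ + i.2) = q * z := by exact_mod_cast hz
    refine (distNearestInt_le _ z).trans ?_
    have e : blockValue q r i * α - γ - z =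
        blockValue q r i * (α - a / q) + (⌈γ * q⌉ + i.2 - γ * q) / q := by
      field_simp
      linarith
    have c1 := Int.le_ceil (γ * q)
    have c2 := Int.ceil_lt_add_one (γ * q)
    have hj : (1 : ℝ) ≤ i.2 := by exact_mod_cast j1
    rw [e]
    refine (abs_add_le _ _).trans ?_
    have b1 : |(blockValue q r i : ℝ) * (α - a / q)| ≤ 1 / q := by
      rw [abs_mul, abs_of_pos hn0]
      calc (blockValue q r i : ℝ) * |α - a / q| ≤ (q : ℝ) ^ 2 * (1 / (q : ℝ) ^ 3) := by gcongr
        _ = 1 / q := by field_simp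
    have b2 : |((⌈γ * q⌉ : ℝ) + i.2 - γ * q) / q| ≤ (i.2 + 1) / q := by
      rw [abs_div, abs_of_pos hq0, abs_of_nonneg (by linarith)]
      gcongr
      linarith
    calc _ ≤ 1 / (q : ℝ) + (i.2 + 1) / q := add_le_add b1 b2
      _ = (i.2 + 2) / q := by ring
      _ ≤ 3 * i.2 / q := by gcongr; linarith
  -- The constant is 2 · 40² · 3, from n ≤ 2qt, log n ≤ 40 log P and the distance bound 3j/q.
  calc liouvilleFactor α γ (blockValue q r i)
      ≤ (2 * q * i.1) * (40 * Real.log P) ^ 2 * (3 * i.2 / q) := by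
        unfold liouvilleFactor
        have := distNearestInt_nonneg (blockValue q r i * α - γ)
        gcongr
    _ = 9600 * ((i.1 : ℝ) * i.2 * Real.log P ^ 2) := by field_simp; ring

/-! ### From blocks to limsup sets of full measure. -/

theorem measure_forall_ge_notMem_nearMultiples_le {α : ℝ} (hα : Liouville α) (γ : ℝ)
    (γ' : UnitAddCircle) {L : ℝ} (hL : 0 < L) (N : ℕ) :
    volume (⋂ n ≥ N, (nearMultiples γ' n (L * approxRate α γ n))ᶜ) ≤
      ENNReal.ofReal (7680000 / L) := by
  obtain ⟨P₀, hP₀⟩ : ∃ P₀ : ℕ, 8 ≤ P₀ ∧ 2 * L ≤ P₀ := by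
    obtain ⟨k, hk⟩ := exists_nat_ge (2 * L)
    exact ⟨max 8 k, le_max_left _ _, hk.trans (by exact_mod_cast le_max_right _ _)⟩
  obtain ⟨a, q, hBq, hcop, hαq⟩ := hα.exists_isCoprime_abs_sub_lt 3 (max N (P₀ ^ 10))
  obtain ⟨P, hPP₀, hPq, hqP⟩ := exists_pow_ten_bracket P₀ q ((le_max_right _ _).trans hBq)
  have hP8 : 8 ≤ P := hP₀.1.trans hPP₀
  obtain ⟨r, J, h, hr, hJ⟩ := exists_isResidueBlock ⌈γ * q⌉ hcop (by omega) hPq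
  have hPR : (8 : ℝ) ≤ P := by exact_mod_cast hP8
  have hPL : 2 * L ≤ P := hP₀.2.trans (by exact_mod_cast hPP₀)
  have hlog : 2 ≤ Real.log P := by
    rw [Real.le_log_iff_exp_le (by linarith)]
    have h1 : Real.exp 2 = Real.exp 1 * Real.exp 1 := by rw [← Real.exp_add]; norm_num
    have h2 := Real.exp_one_lt_d9
    have h3 := Real.exp_pos 1
    nlinarith
  set l := Real.log P
  -- This b makes b/(tj) at most L times the approximation rate, while 800/(b l²) becomes 7680000/L,
  -- independent of P.
  have hb : 0 < L / (9600 * l ^ 2) := by positivity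
  have hbP : 2 * (L / (9600 * l ^ 2)) ≤ (P : ℝ) ^ 2 := by
    have : L / (9600 * l ^ 2) ≤ L := div_le_self hL.le (by nlinarith)
    nlinarith
  have hmain := h.measure_avoid_le γ' hb hbP hlog hJ
  have e : 800 / (L / (9600 * l ^ 2) * l ^ 2) = 7680000 / L := by
    field_simp
    norm_num
  rw [e] at hmain
  refine (measure_mono ?_).trans ((ENNReal.le_ofReal_iff_toReal_le (measure_ne_top _ _)
    (by positivity)).2 hmain)
  intro y hy
  simp only [Set.mem_iInter] at hy ⊢
  intro i hi hmem
  obtain ⟨t1, -, j1, -⟩ := h.mem_blockIndex hi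
  have hN : N ≤ blockValue q r i := by
    calc N ≤ q := (le_max_left _ _).trans hBq
      _ ≤ q * i.1 := Nat.le_mul_of_pos_right _ (by omega)
      _ ≤ _ := Nat.le_add_right _ _
  refine hy _ hN (le_trans (show ‖blockValue q r i • y - γ'‖ ≤ _ from hmem) ?_)
  have ht : (1 : ℝ) ≤ i.1 := by exact_mod_cast (by omega : 1 ≤ i.1)
  have hj : (1 : ℝ) ≤ i.2 := by exact_mod_cast j1
  have hmax : max 1 (liouvilleFactor α γ (blockValue q r i)) ≤
      9600 * ((i.1 : ℝ) * i.2 * l ^ 2) := by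
    refine max_le ?_ (h.liouvilleFactor_le hr hαq hqP hi)
    have h1 : (1 : ℝ) ≤ i.1 * i.2 := one_le_mul_of_one_le_of_one_le ht hj
    have h2 : (1 : ℝ) ≤ l ^ 2 := one_le_pow₀ (by linarith)
    nlinarith [one_le_mul_of_one_le_of_one_le h1 h2]
  calc L / (9600 * l ^ 2) * ((i.1 : ℝ) * i.2)⁻¹
      = L * (9600 * ((i.1 : ℝ) * i.2 * l ^ 2))⁻¹ := by field_simp
    _ ≤ L * approxRate α γ (blockValue q r i) := by
        unfold approxRate
        gcongr

/-- Points of the circle that are infinitely often within `L w n` of `γ` after multiplication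
by `n`. -/
def limsupNearMultiples (γ : UnitAddCircle) (w : ℕ → ℝ) (L : ℝ) : Set UnitAddCircle :=
  {y | ∃ᶠ n in atTop, y ∈ nearMultiples γ n (L * w n)}

theorem measure_compl_limsupNearMultiples_le {α : ℝ} (hα : Liouville α) (γ : ℝ)
    (γ' : UnitAddCircle) {L : ℝ} (hL : 0 < L) :
    volume (limsupNearMultiples γ' (approxRate α γ) L)ᶜ ≤ ENNReal.ofReal (7680000 / L) := by
  have e : (limsupNearMultiples γ' (approxRate α γ) L)ᶜ =
      ⋃ N : ℕ, ⋂ n ≥ N, (nearMultiples γ' n (L * approxRate α γ n))ᶜ := by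
    ext y
    simp [limsupNearMultiples]
  have hmono : Monotone fun N : ℕ => ⋂ n ≥ N, (nearMultiples γ' n (L * approxRate α γ n))ᶜ := by
    intro M N hMN
    exact Set.biInter_mono (fun n (hn : N ≤ n) => hMN.trans hn) fun _ _ => subset_rfl
  rw [e, hmono.measure_iUnion]
  exact iSup_le fun N => measure_forall_ge_notMem_nearMultiples_le hα γ γ' hL N

/-- Dividing by n a lift of ny - γ close to an integer moves y to an exact solution. This puts the
sets in the form that the scaling theorem for limsups of thickenings needs. -/
theorem nearMultiples_eq_cthickening (γ : UnitAddCircle) {n : ℕ} (hn : 0 < n) {a : ℝ}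
    (ha : 0 ≤ a) : nearMultiples γ n a = cthickening (a / n) {y | n • y = γ} := by
  have hnR : (0 : ℝ) < n := by exact_mod_cast hn
  have hclosed : IsClosed {y : UnitAddCircle | n • y = γ} :=
    isClosed_eq (by fun_prop) continuous_const
  apply Set.Subset.antisymm
  · intro y hy
    obtain ⟨x, rfl⟩ : ∃ x : ℝ, (x : UnitAddCircle) = y := QuotientAddGroup.mk_surjective _
    obtain ⟨g, rfl⟩ : ∃ g : ℝ, (g : UnitAddCircle) = γ := QuotientAddGroup.mk_surjective _
    have hy' : ‖((n * x - g : ℝ) : UnitAddCircle)‖ ≤ a := by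
      rw [AddCircle.coe_sub, ← nsmul_eq_mul, AddCircle.coe_nsmul]
      exact hy
    obtain ⟨z, hz⟩ := UnitAddCircle.norm_coe_le_iff.1 hy'
    apply mem_cthickening_of_dist_le _ (((g + z) / n : ℝ) : UnitAddCircle)
    · show n • (((g + z) / n : ℝ) : UnitAddCircle) = g
      rw [← AddCircle.coe_nsmul, nsmul_eq_mul, mul_div_cancel₀ _ hnR.ne', AddCircle.coe_add]
      have : ((z : ℝ) : UnitAddCircle) = 0 := (AddCircle.coe_eq_zero_iff (1 : ℝ)).2 ⟨z, by simp⟩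
      rw [this, add_zero]
    · rw [dist_eq_norm, ← AddCircle.coe_sub]
      refine UnitAddCircle.norm_coe_le_iff.2 ⟨0, ?_⟩
      have : x - (g + z) / n - ((0 : ℤ) : ℝ) = (n * x - g - z) / n := by
        push_cast; field_simp; ring
      rw [this, abs_div, abs_of_pos hnR]
      gcongr
  · rw [hclosed.cthickening_eq_biUnion_closedBall (by positivity)]
    intro y hy
    obtain ⟨x, hx, hxy⟩ := Set.mem_iUnion₂.1 hy
    rw [mem_closedBall, dist_eq_norm, le_div_iff₀ hnR] at hxy
    show ‖n • y - γ‖ ≤ a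
    have hx' : n • x = γ := hx
    rw [← hx', ← smul_sub]
    refine (norm_nsmul_le).trans ?_
    rw [mul_comm]
    exact hxy

/-- A consequence of Lebesgue density: limsups of thickenings with radii tending to 0 are
insensitive, up to null sets, to a constant factor in the radii. The bound w ≤ 1, the purpose of
truncating the rate, makes the radii w n / n tend to 0. -/
theorem limsupNearMultiples_ae_eq (γ : UnitAddCircle) {w : ℕ → ℝ} (hw0 : ∀ n, 0 ≤ w n)
    (hw1 : ∀ n, w n ≤ 1) {L : ℝ} (hL : 0 < L) :
    limsupNearMultiples γ w L =ᵐ[volume] limsupNearMultiples γ w 1 := by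
  have key : ∀ M : ℝ, 0 < M → limsupNearMultiples γ w M =
      blimsup (fun n => cthickening (M * (w n / n)) {y : UnitAddCircle | n • y = γ}) atTop
        (fun _ => True) := by
    intro M hM
    rw [blimsup_true]
    ext y
    rw [mem_limsup_iff_frequently_mem]
    refine frequently_congr ?_
    filter_upwards [eventually_gt_atTop 0] with n hn
    rw [nearMultiples_eq_cthickening γ hn (mul_nonneg hM.le (hw0 n)), mul_div_assoc]
  have hr : Tendsto (fun n : ℕ => w n / n) atTop (𝓝 0) := by
    refine squeeze_zero (fun n => div_nonneg (hw0 n) n.cast_nonneg) (fun n => ?_)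
      (tendsto_one_div_atTop_nhds_zero_nat (𝕜 := ℝ))
    gcongr
    exact hw1 n
  rw [key L hL, key 1 one_pos]
  have := blimsup_cthickening_mul_ae_eq volume (fun _ => True)
    (fun n : ℕ => {y : UnitAddCircle | n • y = γ}) hL _ hr
  simpa only [one_mul] using this

theorem ae_mem_limsupNearMultiples {α : ℝ} (hα : Liouville α) (γ : ℝ) (γ' : UnitAddCircle)
    {L : ℝ} (hL : 0 < L) : ∀ᵐ y, y ∈ limsupNearMultiples γ' (approxRate α γ) L := by
  have hae : ∀ {M : ℝ}, 0 < M → limsupNearMultiples γ' (approxRate α γ) M =ᵐ[volume]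
      limsupNearMultiples γ' (approxRate α γ) 1 := fun hM =>
    limsupNearMultiples_ae_eq γ' (approxRate_nonneg α γ) (approxRate_le_one α γ) hM
  have hbound : ∀ n : ℕ, volume (limsupNearMultiples γ' (approxRate α γ) L)ᶜ ≤
      ENNReal.ofReal (7680000 / (n + 1 : ℝ)) := by
    intro n
    -- Replace L by n + 1 at no cost in measure; the bound then tends to 0.
    rw [measure_congr ((hae hL).trans (hae (n.cast_add_one_pos (α := ℝ))).symm).compl]
    exact measure_compl_limsupNearMultiples_le hα γ γ' n.cast_add_one_pos
  have ht : Tendsto (fun n : ℕ => ENNReal.ofReal (7680000 / (n + 1 : ℝ))) atTop (𝓝 0) := by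
    rw [← ENNReal.ofReal_zero]
    refine ENNReal.tendsto_ofReal ?_
    simpa [div_eq_mul_inv] using
      (tendsto_one_div_add_atTop_nhds_zero_nat (𝕜 := ℝ)).const_mul 7680000
  exact le_antisymm (ge_of_tendsto' ht hbound) bot_le

theorem theorem1p10 (α₁ : ℝ) (hα₁ : Liouville α₁) (γ₁ γ₂ : ℝ) :
    ∀ᵐ α₂ : ℝ ∂MeasureTheory.volume,
      Filter.liminf
        (fun n : ℕ =>
          (((n : ℝ) * (Real.log (n : ℝ)) ^ 2 * distNearestInt ((n : ℝ) * α₁ - γ₁) *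
            distNearestInt ((n : ℝ) * α₂ - γ₂) : ℝ) : EReal))
        Filter.atTop = 0 := by
  have hcircle : ∀ᵐ y : UnitAddCircle, ∀ k : ℕ,
      y ∈ limsupNearMultiples γ₂ (approxRate α₁ γ₁) (1 / (k + 1)) :=
    ae_all_iff.2 fun k => ae_mem_limsupNearMultiples hα₁ γ₁ γ₂ Nat.one_div_pos_of_nat
  have hreal : ∀ᵐ x : ℝ, ∀ k : ℕ,
      (x : UnitAddCircle) ∈ limsupNearMultiples γ₂ (approxRate α₁ γ₁) (1 / (k + 1)) := by
    -- The quotient map is measure preserving on each unit interval, and countably many of these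
    -- cover the line.
    have hloc : ∀ z : ℤ, ∀ᵐ x : ℝ ∂volume.restrict (Set.Ioc (z : ℝ) (z + 1)), ∀ k : ℕ,
        (x : UnitAddCircle) ∈ limsupNearMultiples γ₂ (approxRate α₁ γ₁) (1 / (k + 1)) :=
      fun z => (UnitAddCircle.measurePreserving_mk z).quasiMeasurePreserving.ae hcircle
    have := (ae_restrict_iUnion_iff (fun z : ℤ => Set.Ioc (z : ℝ) (z + 1)) _).2 hloc
    rwa [iUnion_Ioc_intCast, Measure.restrict_univ] at this
  filter_upwards [hreal] with x hx
  have hnn : ∀ n : ℕ, 0 ≤ (n : ℝ) * (Real.log (n : ℝ)) ^ 2 *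
      distNearestInt ((n : ℝ) * α₁ - γ₁) * distNearestInt ((n : ℝ) * x - γ₂) := fun n =>
    mul_nonneg (liouvilleFactor_nonneg α₁ γ₁ n) (distNearestInt_nonneg _)
  apply le_antisymm
  · have hle : ∀ k : ℕ, liminf (fun n : ℕ =>
        (((n : ℝ) * (Real.log (n : ℝ)) ^ 2 * distNearestInt ((n : ℝ) * α₁ - γ₁) *
          distNearestInt ((n : ℝ) * x - γ₂) : ℝ) : EReal)) atTop ≤
        ((1 / (k + 1 : ℝ) : ℝ) : EReal) := by
      intro k
      refine liminf_le_of_frequently_le' ((hx k).mono fun n hn => EReal.coe_le_coe_iff.2 ?_)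
      have hn' : distNearestInt (n * x - γ₂) ≤ 1 / (k + 1) * approxRate α₁ γ₁ n := by
        rw [distNearestInt_eq_norm, AddCircle.coe_sub, ← nsmul_eq_mul, AddCircle.coe_nsmul]
        exact hn
      have h0 := liouvilleFactor_nonneg α₁ γ₁ n
      have hm : 0 < max 1 (liouvilleFactor α₁ γ₁ n) := lt_max_of_lt_left one_pos
      calc liouvilleFactor α₁ γ₁ n * distNearestInt (n * x - γ₂)
          ≤ max 1 (liouvilleFactor α₁ γ₁ n) * (1 / (k + 1) * approxRate α₁ γ₁ n) := by
            gcongr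
            · exact distNearestInt_nonneg _
            · exact le_max_right _ _
        _ = 1 / (k + 1) := by
            unfold approxRate
            field_simp
    have ht : Tendsto (fun k : ℕ => ((1 / (k + 1 : ℝ) : ℝ) : EReal)) atTop (𝓝 0) :=
      (continuous_coe_real_ereal.tendsto 0).comp tendsto_one_div_add_atTop_nhds_zero_nat
    exact ge_of_tendsto' ht hle
  · refine le_liminf_of_le (by isBoundedDefault) (Eventually.of_forall fun n => ?_)
    exact_mod_cast hnn n
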